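/- **Model.** An insertion-only stream over $[n]$ is a sequence of updates $(i_t,\Delta_t)\in[n]\times\{0,1,\dots,M\}$; its frequency vector $\mathcal X\in\mathbb Z_{\ge 0}^n$ has the coordinates $\mathcal X_i=\sum_{t:\,i_t=i}\Delta_t$. For $\mathcal X\ne 0$, the empirical Shannon entropy is $H(\mathcal X)=\sum_{i:\,\mathcal X_i\neq 0} p_i\log(1/p_i)$ with $p_i=\mathcal X_i/\|\mathcal X\|_1$ (natural logarithm). A streaming algorithm with $s$ bits of space in the random-oracle model has a memory of $s$ bits. It starts from a fixed memory content, and at each update it replaces the content by a function of the old content, the update, a string of random bits (the oracle: of arbitrary finite length, drawn once before the stream, always available and not charged as space), and a number of fresh random bits tossed for this update. After the last update it outputs a real number, a function of the oracle and the memory content. All random bits are independent and fair, and computation is not charged. Space is thus measured between updates. **Theorem.** For every $c\in\mathbb N$ there is a constant $C>0$ such that the following holds for all integers $n\ge 3$ and $0\le m,M\le n^c$ and all real $0<\epsilon<1$. There is a streaming algorithm in the random-oracle model (which may depend on $n,m,M,\epsilon$) that uses at most $$C\cdot\frac1{\epsilon^{2}}\Bigl(\log\log n+\log\frac1\epsilon\Bigr)$$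 bits of space and such that, for every fixed insertion-only stream over $[n]$ of length at most $m$ with increments in $\{0,\dots,M\}$ and frequency vector $\mathcal X\ne0$, its output $\tilde H$ satisfies $|\tilde H-H(\mathcal X)|\le\epsilon$ with probability at least $3/4$. -/

import Mathlib

namespace EntropyStream

/-- An insertion-only update `(i, Δ)` with `i ∈ [n]` and `Δ ∈ {0, …, M}`. -/
abbrev Update (n M : ℕ) : Type := Fin n × Fin (M + 1)

/-- The frequency vector of the stream `σ 0, …, σ (L - 1)`: coordinate `i` is the sum of all
increments `Δ` of the updates `(i, Δ)` in the stream. -/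
def freq {n M L : ℕ} (σ : Fin L → Update n M) (i : Fin n) : ℕ :=
  ∑ t : Fin L, if (σ t).1 = i then ((σ t).2 : ℕ) else 0

/-- The `ℓ₁` norm of a vector with non-negative integer entries. -/
def l1 {n : ℕ} (x : Fin n → ℕ) : ℕ := ∑ i, x i

/-- The empirical Shannon entropy `∑ᵢ pᵢ log (1 / pᵢ)` with `pᵢ = xᵢ / ‖x‖₁` (natural logarithm).
Coordinates with `xᵢ = 0` contribute `0`. -/
noncomputable def entropy {n : ℕ} (x : Fin n → ℕ) : ℝ :=
  ∑ i, ((x i : ℝ) / (l1 x : ℝ)) * Real.log ((l1 x : ℝ) / (x i : ℝ))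

/-- Strings of `k` bits. -/
abbrev Bits (k : ℕ) : Type := Fin k → Bool

/-- A randomized streaming algorithm with `s` bits of memory in the random-oracle model, for
insertion-only streams over `[n]` with increments at most `M`.

* The random oracle is a string of `oracleLen` random bits, drawn once before the stream. It may be
  arbitrarily long, can be consulted during every update and when the output is computed, and is not
  charged as memory.
* While an update is processed, the algorithm may in addition toss `coinLen` fresh coins. They are
  gone afterwards, unless the algorithm keeps them in its memory.
* All that passes from one update to the next is the content of the memory, a string of `s` bits. In
  particular the algorithm is not told how many updates it has seen. -/
structure Algorithm (n M s : ℕ) where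
  /-- The number of bits of the random oracle. -/
  oracleLen : ℕ
  /-- The number of fresh coins per update. -/
  coinLen : ℕ
  /-- The initial content of the memory. -/
  init : Bits s
  /-- The new content of the memory, from the oracle, the fresh coins, the old content and the
  update. -/
  update : Bits oracleLen → Bits coinLen → Bits s → Update n M → Bits s
  /-- The estimate, from the oracle and the final content of the memory. -/
  output : Bits oracleLen → Bits s → ℝ

namespace Algorithm

variable {n M s : ℕ}

/-- The outcomes of all random bits in a run on a stream of length `L`: the oracle, and the fresh
coins of each of the `L` updates. -/
abbrev Randomness (A : Algorithm n M s) (L : ℕ) : Type :=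
  Bits A.oracleLen × (Fin L → Bits A.coinLen)

/-- The content of the memory after the stream `σ` has been read, in order. -/
def finalState (A : Algorithm n M s) {L : ℕ} (ρ : A.Randomness L) (σ : Fin L → Update n M) :
    Bits s :=
  Fin.foldl L (fun state t => A.update ρ.1 (ρ.2 t) state (σ t)) A.init

/-- The estimate that the algorithm outputs at the end of the stream `σ`. -/
def estimate (A : Algorithm n M s) {L : ℕ} (ρ : A.Randomness L) (σ : Fin L → Update n M) : ℝ :=
  A.output ρ.1 (A.finalState ρ σ)

/-- The probability of an event when all random bits are independent and fair, that is, when the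
outcome `ρ` is uniformly distributed. -/
noncomputable def prob (A : Algorithm n M s) {L : ℕ} (E : Set (A.Randomness L)) : ℝ :=
  (Nat.card E : ℝ) / (Nat.card (A.Randomness L) : ℝ)

end Algorithm

end EntropyStream

/-!
Let `r` be uniform in `{1, …, R}`. The discrete Pareto variable `⌊R / r⌋` has a Laplace transform
`φ` with `log φ(z) ≈ z log z` for small `z`. Hence if `S` is the linear sketch of `x` in which every
coordinate is weighted by a sum of `N` independent such variables, then `log 𝔼 exp (-b S)` is close
to `N ∑ᵢ b xᵢ log (b xᵢ)`. For `b = 1 / (N ‖x‖₁)` this is `-H(x) - log N`, and for twice this `b` it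
shows that the second moment of `exp (-b S)` is at most a constant times the squared mean. By the
Chebyshev inequality the average of `exp (-b S)` over `k ≈ 1 / ε²` independent sketches therefore
determines `H(x)` up to `O(ε)`.

The oracle supplies the Pareto variables. Only `‖x‖₁` and the `k` sketches are stored. All of them
are sums of nonnegative increments, so a floating-point counter with unbiased random rounding keeps
each of them up to a relative error `η` in `O(log (1 / η) + log log X)` bits, where `X` bounds
`‖x‖₁`. Values of `b S` beyond `O(log X)` do not matter, so `η ≈ ε / log X` is small enough.
-/

namespace EntropyStream

open Finset
open scoped BigOperators

section UniformProb

variable {Ω Ω' : Type*}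

/-- The probability of the event `E` for a uniformly distributed point of the finite type `Ω`. For
`Ω = A.Randomness L` this is `A.prob E` by definition. -/
noncomputable def uniformProb (E : Set Ω) : ℝ := (Nat.card E : ℝ) / (Nat.card Ω : ℝ)

theorem uniformProb_eq_expect [Fintype Ω] (E : Set Ω) :
    uniformProb E = 𝔼 ω, E.indicator (1 : Ω → ℝ) ω := by
  classical
  simp [uniformProb, Fintype.expect_eq_sum_div_card, Set.indicator_apply, Fintype.card_subtype]

theorem uniformProb_mono [Finite Ω] {E E' : Set Ω} (h : E ⊆ E') :
    uniformProb E ≤ uniformProb E' := by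
  unfold uniformProb
  gcongr
  exact Nat.card_mono (Set.toFinite _) h

theorem uniformProb_compl [Finite Ω] [Nonempty Ω] (E : Set Ω) :
    uniformProb Eᶜ = 1 - uniformProb E := by
  have hΩ : (Nat.card Ω : ℝ) ≠ 0 := Nat.cast_ne_zero.2 Nat.card_pos.ne'
  have hcard : (E.ncard : ℝ) + (Eᶜ.ncard : ℝ) = Nat.card Ω := by
    exact_mod_cast Set.ncard_add_ncard_compl E
  rw [uniformProb, uniformProb, Nat.card_coe_set_eq, Nat.card_coe_set_eq]
  field_simp
  linarith

theorem uniformProb_union_le (E E' : Set Ω) :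
    uniformProb (E ∪ E') ≤ uniformProb E + uniformProb E' := by
  unfold uniformProb
  rw [← add_div]
  gcongr
  simp only [Nat.card_coe_set_eq]
  exact_mod_cast Set.ncard_union_le E E'

theorem uniformProb_iUnion_le {ι : Type*} [Fintype ι] (E : ι → Set Ω) :
    uniformProb (⋃ i, E i) ≤ ∑ i, uniformProb (E i) := by
  unfold uniformProb
  rw [← sum_div]
  gcongr
  simp only [Nat.card_coe_set_eq]
  exact_mod_cast (by simpa using univ.set_ncard_biUnion_le E)

theorem uniformProb_preimage_equiv (e : Ω ≃ Ω') (E : Set Ω') :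
    uniformProb (e ⁻¹' E) = uniformProb E := by
  have hE : Nat.card (e ⁻¹' E) = Nat.card E :=
    Nat.card_congr (e.subtypeEquiv fun _ => Iff.rfl)
  rw [uniformProb, uniformProb, hE, Nat.card_congr e]

theorem uniformProb_preimage_fst [Finite Ω'] [Nonempty Ω'] (E : Set Ω) :
    uniformProb (Prod.fst ⁻¹' E : Set (Ω × Ω')) = uniformProb E := by
  have hΩ' : (Nat.card Ω' : ℝ) ≠ 0 := Nat.cast_ne_zero.2 Nat.card_pos.ne'
  rw [uniformProb, uniformProb, ← Set.prod_univ, Nat.card_coe_set_eq, Set.ncard_prod,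
    Set.ncard_univ, Nat.card_prod, Nat.card_coe_set_eq, Nat.cast_mul, Nat.cast_mul,
    mul_div_mul_right _ _ hΩ']

theorem uniformProb_le_of_forall_section [Finite Ω] [Nonempty Ω] [Finite Ω'] {E : Set (Ω × Ω')}
    {p : ℝ} (h : ∀ ω, uniformProb (Prod.mk ω ⁻¹' E) ≤ p) : uniformProb E ≤ p := by
  cases nonempty_fintype Ω
  cases nonempty_fintype Ω'
  rw [uniformProb_eq_expect, ← univ_product_univ, expect_product]
  refine expect_le univ_nonempty fun ω _ => ?_
  exact (uniformProb_eq_expect _).symm.trans_le (h ω)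

theorem one_sub_sub_le_uniformProb [Finite Ω] [Finite Ω'] [Nonempty Ω] [Nonempty Ω']
    {B : Set Ω} {B' : Ω → Set Ω'} {G : Set (Ω × Ω')} {p q : ℝ}
    (hB : uniformProb B ≤ p) (hB' : ∀ ω, uniformProb (B' ω) ≤ q)
    (hG : ∀ ω ω', ω ∉ B → ω' ∉ B' ω → (ω, ω') ∈ G) : 1 - p - q ≤ uniformProb G := by
  have hsub : Gᶜ ⊆ Prod.fst ⁻¹' B ∪ {x | x.2 ∈ B' x.1} := by
    rintro ⟨ω, ω'⟩ hω
    by_contra h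
    exact hω (hG ω ω' (fun hB => h (Or.inl hB)) fun hB' => h (Or.inr hB'))
  have hfst : uniformProb (Prod.fst ⁻¹' B : Set (Ω × Ω')) ≤ p :=
    (uniformProb_preimage_fst B).trans_le hB
  have hsnd : uniformProb {x : Ω × Ω' | x.2 ∈ B' x.1} ≤ q := uniformProb_le_of_forall_section hB'
  linarith [uniformProb_compl G, uniformProb_mono hsub, uniformProb_union_le
    (Prod.fst ⁻¹' B : Set (Ω × Ω')) {x | x.2 ∈ B' x.1}]

variable [Fintype Ω]

theorem uniformProb_lt_abs_le (X : Ω → ℝ) {t : ℝ} (ht : 0 < t) :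
    uniformProb {ω | t < |X ω|} ≤ (𝔼 ω, X ω ^ 2) / t ^ 2 := by
  rw [le_div_iff₀ (by positivity), uniformProb_eq_expect, expect_mul]
  refine expect_le_expect fun ω _ => ?_
  by_cases hω : t < |X ω|
  · rw [Set.indicator_of_mem (show ω ∈ {ω | t < |X ω|} from hω), Pi.one_apply, one_mul,
      ← sq_abs (X ω)]
    gcongr
  · rw [Set.indicator_of_notMem (show ω ∉ {ω | t < |X ω|} from hω), zero_mul]
    positivity

theorem expect_sub_const_sq [Nonempty Ω] (X : Ω → ℝ) (c : ℝ) :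
    𝔼 ω, (X ω - c) ^ 2 = 𝔼 ω, X ω ^ 2 - 2 * c * 𝔼 ω, X ω + c ^ 2 := by
  have hsq : ∀ ω, (X ω - c) ^ 2 = X ω ^ 2 - 2 * c * X ω + c ^ 2 := fun ω => by ring
  simp_rw [hsq, expect_add_distrib, expect_sub_distrib, ← mul_expect, Fintype.expect_const]

theorem expect_exp_pos [Nonempty Ω] (f : Ω → ℝ) : 0 < 𝔼 ω, Real.exp (f ω) :=
  expect_pos (fun _ _ => Real.exp_pos _) univ_nonempty

theorem expect_prod_apply {ι : Type*} [Fintype ι] [DecidableEq ι] (f : ι → Ω → ℝ) :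
    𝔼 ω : ι → Ω, ∏ i, f i (ω i) = ∏ i, 𝔼 a, f i a := by
  simp_rw [Fintype.expect_eq_sum_div_card]
  rw [prod_div_distrib, prod_univ_sum, Fintype.piFinset_univ]
  simp

theorem expect_fin_succ {k : ℕ} (F : (Fin (k + 1) → Ω) → ℝ) :
    𝔼 o, F o = 𝔼 a, 𝔼 o : Fin k → Ω, F (Fin.cons a o) := by
  rw [← Fintype.expect_equiv (Fin.consEquiv fun _ => Ω) (fun p => F (Fin.cons p.1 p.2)) F
    fun _ => rfl, ← univ_product_univ, expect_product]

section SampleMean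

variable [Nonempty Ω]

theorem expect_sum_apply (g : Ω → ℝ) (k : ℕ) :
    𝔼 o : Fin k → Ω, ∑ j, g (o j) = k * 𝔼 ω, g ω := by
  induction k with
  | zero => simp
  | succ k ih =>
    simp_rw [expect_fin_succ, Fin.sum_univ_succ, Fin.cons_zero, Fin.cons_succ, expect_add_distrib,
      Fintype.expect_const, ih]
    push_cast
    ring

theorem expect_sum_apply_sq {g : Ω → ℝ} (hg : 𝔼 ω, g ω = 0) (k : ℕ) :
    𝔼 o : Fin k → Ω, (∑ j, g (o j)) ^ 2 = k * 𝔼 ω, g ω ^ 2 := by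
  induction k with
  | zero => simp
  | succ k ih =>
    have hmean : 𝔼 o : Fin k → Ω, ∑ j, g (o j) = 0 := by rw [expect_sum_apply, hg, mul_zero]
    simp_rw [expect_fin_succ, Fin.sum_univ_succ, Fin.cons_zero, Fin.cons_succ, add_sq,
      expect_add_distrib, ← mul_expect, hmean, ih, Fintype.expect_const, mul_zero,
      expect_const_zero]
    push_cast
    ring

theorem uniformProb_lt_abs_sampleMean_sub_le (f : Ω → ℝ) {k : ℕ} (hk : 0 < k) {t : ℝ}
    (ht : 0 < t) :
    uniformProb {o : Fin k → Ω | t < |(∑ j, f (o j)) / k - 𝔼 ω, f ω|}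
      ≤ (𝔼 ω, f ω ^ 2) / (k * t ^ 2) := by
  set e := 𝔼 ω, f ω with he
  have hk' : (k : ℝ) ≠ 0 := by positivity
  have hcenter : 𝔼 ω, (f ω - e) = 0 := by
    rw [expect_sub_distrib, Fintype.expect_const, ← he, sub_self]
  have hvar : 𝔼 ω, (f ω - e) ^ 2 ≤ 𝔼 ω, f ω ^ 2 := by
    rw [expect_sub_const_sq, ← he]
    nlinarith [sq_nonneg e]
  have hdev : ∀ o : Fin k → Ω,
      ((∑ j, f (o j)) / k - e) ^ 2 = (∑ j, (f (o j) - e)) ^ 2 / (k : ℝ) ^ 2 := by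
    intro o
    rw [sum_sub_distrib, sum_const, card_univ, Fintype.card_fin, nsmul_eq_mul]
    field_simp
  calc uniformProb {o : Fin k → Ω | t < |(∑ j, f (o j)) / k - e|}
      ≤ (𝔼 o : Fin k → Ω, ((∑ j, f (o j)) / k - e) ^ 2) / t ^ 2 := uniformProb_lt_abs_le _ ht
    _ = (𝔼 ω, (f ω - e) ^ 2) / (k * t ^ 2) := by
        simp_rw [hdev]
        rw [← expect_div, expect_sum_apply_sq hcenter]
        field_simp
    _ ≤ (𝔼 ω, f ω ^ 2) / (k * t ^ 2) := by gcongr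

end SampleMean

end UniformProb

section RandomizedRounding

theorem expect_fin_mod {d D : ℕ} (hd : d ∣ D) (hD : 0 < D) (f : ℕ → ℝ) :
    𝔼 u : Fin D, f (u % d) = 𝔼 u : Fin d, f u := by
  obtain ⟨q, rfl⟩ := exists_eq_mul_left_of_dvd hd
  have : Nonempty (Fin q) := ⟨⟨0, Nat.pos_of_mul_pos_right hD⟩⟩
  rw [← Fintype.expect_equiv finProdFinEquiv (fun p : Fin q × Fin d => f p.2) _ fun p => by
      rw [finProdFinEquiv_apply_val, Nat.add_mul_mod_self_left, Nat.mod_eq_of_lt p.2.isLt],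
    ← univ_product_univ, expect_product]
  exact Fintype.expect_const (𝔼 u : Fin d, f u)

theorem sum_range_apply_add_div (f : ℕ → ℝ) {d : ℕ} (hd : 0 < d) (v : ℕ) :
    ∑ u ∈ range d, f ((v + u) / d)
      = (d - (v % d : ℕ)) * f (v / d) + (v % d : ℕ) * f (v / d + 1) := by
  have hr : v % d < d := Nat.mod_lt v hd
  have hcarry : ∀ u ∈ range d,
      f ((v + u) / d) = if u < d - v % d then f (v / d) else f (v / d + 1) := by
    intro u hu
    have hu' : u < d := mem_range.1 hu
    rw [Nat.add_div hd, Nat.div_eq_of_lt hu', Nat.mod_eq_of_lt hu']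
    split_ifs <;> first | rfl | omega
  have hlow : {u ∈ range d | u < d - v % d} = range (d - v % d) := by
    ext u
    simp only [mem_filter, mem_range]
    omega
  have hhigh : {u ∈ range d | ¬u < d - v % d} = Ico (d - v % d) d := by
    ext u
    simp only [mem_filter, mem_range, mem_Ico]
    omega
  rw [sum_congr rfl hcarry, sum_ite, hlow, hhigh, sum_const, sum_const, card_range, Nat.card_Ico,
    Nat.sub_sub_self hr.le, nsmul_eq_mul, nsmul_eq_mul, Nat.cast_sub hr.le]

/-- Randomized rounding of `v` to a neighbouring multiple of `d`. It is unbiased when `u` is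
uniformly distributed modulo `d`. -/
def roundMul (d v u : ℕ) : ℕ := (v + u % d) / d * d

variable {d D : ℕ}

theorem expect_roundMul_apply (hd : d ∣ D) (hD : 0 < D) (v : ℕ) (f : ℕ → ℝ) :
    𝔼 u : Fin D, f (roundMul d v u)
      = ((d - (v % d : ℕ)) * f (v / d * d) + (v % d : ℕ) * f ((v / d + 1) * d)) / d := by
  have hd0 : 0 < d := Nat.pos_of_dvd_of_pos hd hD
  simp only [roundMul]
  rw [expect_fin_mod hd hD fun u => f ((v + u) / d * d), Fintype.expect_eq_sum_div_card,
    Fin.sum_univ_eq_sum_range fun u => f ((v + u) / d * d),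
    sum_range_apply_add_div (fun q => f (q * d)) hd0, Fintype.card_fin]

theorem expect_roundMul (hd : d ∣ D) (hD : 0 < D) (v : ℕ) :
    𝔼 u : Fin D, (roundMul d v u : ℝ) = v := by
  have hd0 : (d : ℝ) ≠ 0 := Nat.cast_ne_zero.2 (Nat.pos_of_dvd_of_pos hd hD).ne'
  have hv : (v : ℝ) = d * (v / d : ℕ) + (v % d : ℕ) := mod_cast (Nat.div_add_mod v d).symm
  rw [expect_roundMul_apply hd hD v fun x => (x : ℝ)]
  push_cast
  rw [div_eq_iff hd0]
  linear_combination -(d : ℝ) * hv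

theorem expect_roundMul_sq_le (hd : d ∣ D) (hD : 0 < D) (v : ℕ) :
    𝔼 u : Fin D, (roundMul d v u : ℝ) ^ 2 ≤ (v : ℝ) ^ 2 + d * (v % d : ℕ) := by
  have hd0 : (0 : ℝ) < d := Nat.cast_pos.2 (Nat.pos_of_dvd_of_pos hd hD)
  have hv : (v : ℝ) = d * (v / d : ℕ) + (v % d : ℕ) := mod_cast (Nat.div_add_mod v d).symm
  rw [expect_roundMul_apply hd hD v fun x => (x : ℝ) ^ 2, div_le_iff₀ hd0, hv]
  push_cast
  have : 0 ≤ (d : ℝ) * ((v % d : ℕ) : ℝ) ^ 2 := by positivity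
  linarith

end RandomizedRounding

section FloatingPoint

variable {β E a v : ℕ}

/-- The exponent of `v` as a floating-point number with `β` mantissa bits. The exponent is bounded
by `E`; numbers from `2 ^ (β + E)` on, which do not fit, get the exponent `0`. -/
def floatExp (β E v : ℕ) : ℕ := if v < 2 ^ (β + E) then v.size - β else 0

/-- Unbiased rounding of `v` to a floating-point number, with the randomness `u`. Numbers from
`2 ^ (β + E)` on are kept exactly, so that the rounding is unbiased without any bound on `v`. -/
def floatRound (β E v u : ℕ) : ℕ := roundMul (2 ^ floatExp β E v) v u

/-- The floating-point numbers `q * 2 ^ e` with `q ≤ 2 ^ β` and `e ≤ E`. -/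
def floats (β E : ℕ) : Finset ℕ :=
  image₂ (fun q e => q * 2 ^ e) (range (2 ^ β + 1)) (range (E + 1))

/-- The numbers that occur as values of `floatRound`. -/
def IsFloat (β E a : ℕ) : Prop := a ∈ floats β E ∨ 2 ^ (β + E) ≤ a

theorem mem_floats : a ∈ floats β E ↔ ∃ q ≤ 2 ^ β, ∃ e ≤ E, q * 2 ^ e = a := by
  simp only [floats, mem_image₂, mem_range, Nat.lt_succ_iff]

theorem card_floats_le (β E : ℕ) : (floats β E).card ≤ (2 ^ β + 1) * (E + 1) :=
  (card_image₂_le ..).trans_eq (by rw [card_range, card_range])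

theorem zero_mem_floats : 0 ∈ floats β E :=
  mem_floats.2 ⟨0, Nat.zero_le _, 0, Nat.zero_le _, by simp⟩

theorem two_pow_mem_floats : 2 ^ (β + E) ∈ floats β E :=
  mem_floats.2 ⟨2 ^ β, le_rfl, E, le_rfl, (pow_add ..).symm⟩

theorem IsFloat.min_mem_floats (ha : IsFloat β E a) : min a (2 ^ (β + E)) ∈ floats β E := by
  rcases ha with ha | ha
  · rcases min_choice a (2 ^ (β + E)) with h | h <;> rw [h]
    exacts [ha, two_pow_mem_floats]
  · rw [min_eq_right ha]
    exact two_pow_mem_floats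

theorem floatExp_of_le (hv : 2 ^ (β + E) ≤ v) : floatExp β E v = 0 := if_neg hv.not_gt

theorem floatExp_le (β E v : ℕ) : floatExp β E v ≤ E := by
  unfold floatExp
  split_ifs with hv
  · have := Nat.size_le.2 hv
    omega
  · exact Nat.zero_le E

theorem two_pow_floatExp_dvd (β E v : ℕ) : 2 ^ floatExp β E v ∣ 2 ^ E :=
  pow_dvd_pow 2 (floatExp_le β E v)

theorem lt_two_pow_add_floatExp (hv : v < 2 ^ (β + E)) : v < 2 ^ (β + floatExp β E v) := by
  rw [← Nat.size_le, floatExp, if_pos hv]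
  omega

theorem two_pow_add_floatExp_le (h : floatExp β E v ≠ 0) : 2 ^ (β + floatExp β E v) ≤ 2 * v := by
  have hsize : β + floatExp β E v = v.size := by
    unfold floatExp at *
    split_ifs at * <;> omega
  obtain ⟨m, hm⟩ : ∃ m, v.size = m + 1 := Nat.exists_eq_succ_of_ne_zero (by omega)
  have : 2 ^ m ≤ v := Nat.lt_size.1 (by omega)
  rw [hsize, hm, pow_succ]
  omega

theorem floatRound_of_le (hv : 2 ^ (β + E) ≤ v) (u : ℕ) : floatRound β E v u = v := by
  rw [floatRound, roundMul, floatExp_of_le hv, pow_zero, Nat.mod_one, Nat.div_one, mul_one,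
    add_zero]

theorem isFloat_floatRound (β E v u : ℕ) : IsFloat β E (floatRound β E v u) := by
  rcases lt_or_ge v (2 ^ (β + E)) with hv | hv
  · refine Or.inl (mem_floats.2 ⟨_, ?_, _, floatExp_le β E v, rfl⟩)
    have hpos : 0 < 2 ^ floatExp β E v := by positivity
    have hmod := Nat.mod_lt u hpos
    have hlt := lt_two_pow_add_floatExp hv
    rw [pow_add] at hlt
    rw [← Nat.lt_succ_iff, Nat.div_lt_iff_lt_mul hpos, Nat.succ_mul]
    omega
  · rw [floatRound_of_le hv]
    exact Or.inr hv

-- Since the float `a ≤ v` does not exceed `v` rounded down, rounding `v = a + w` moves it by a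
-- remainder of at most `w`; this keeps the added variance proportional to the increment `w`.
theorem IsFloat.le_div_mul (hβ : 1 ≤ β) (ha : IsFloat β E a) (hav : a ≤ v) :
    a ≤ v / 2 ^ floatExp β E v * 2 ^ floatExp β E v := by
  rcases ha with ha | ha
  · obtain ⟨q, hq, e, -, rfl⟩ := mem_floats.1 ha
    rcases le_or_gt (floatExp β E v) e with he | he
    · obtain ⟨m, rfl⟩ := Nat.exists_eq_add_of_le' he
      rw [pow_add, ← mul_assoc] at hav ⊢
      exact Nat.mul_le_mul_right _ ((Nat.le_div_iff_mul_le (by positivity)).2 hav)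
    · obtain ⟨b, rfl⟩ := Nat.exists_eq_add_of_le' hβ
      have hpow : 2 ^ (b + 1 + floatExp (b + 1) E v) ≤ 2 * v :=
        two_pow_add_floatExp_le (Nat.ne_zero_of_lt he)
      have hle : 2 ^ b * 2 ^ floatExp (b + 1) E v ≤ v := by
        rw [add_right_comm, pow_succ, pow_add] at hpow
        omega
      calc q * 2 ^ e ≤ 2 ^ (b + 1) * 2 ^ e := Nat.mul_le_mul_right _ hq
        _ = 2 ^ b * 2 ^ (e + 1) := by ring
        _ ≤ 2 ^ b * 2 ^ floatExp (b + 1) E v := by gcongr; exacts [one_le_two, he]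
        _ ≤ _ := Nat.mul_le_mul_right _ ((Nat.le_div_iff_mul_le (by positivity)).2 hle)
  · rw [floatExp_of_le (ha.trans hav)]
    simpa using hav

theorem two_pow_floatExp_mul_mod_le (β E v : ℕ) :
    ((2 ^ floatExp β E v : ℕ) : ℝ) * (v % 2 ^ floatExp β E v : ℕ)
      ≤ 2 / 2 ^ β * v * (v % 2 ^ floatExp β E v : ℕ) := by
  rcases eq_or_ne (floatExp β E v) 0 with h | h
  · simp [h, Nat.mod_one]
  · have hpow : (2 : ℝ) ^ β * 2 ^ floatExp β E v ≤ 2 * v := by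
      rw [← pow_add]
      exact_mod_cast two_pow_add_floatExp_le h
    gcongr
    rw [div_mul_eq_mul_div, le_div_iff₀ (by positivity), Nat.cast_pow, mul_comm]
    exact hpow

theorem expect_floatRound (β E v : ℕ) : 𝔼 u : Fin (2 ^ E), (floatRound β E v u : ℝ) = v :=
  expect_roundMul (two_pow_floatExp_dvd β E v) (by positivity) v

theorem expect_floatRound_sq_le (hβ : 1 ≤ β) (ha : IsFloat β E a) (w : ℕ) :
    𝔼 u : Fin (2 ^ E), (floatRound β E (a + w) u : ℝ) ^ 2
      ≤ (a + w : ℝ) ^ 2 + 2 / 2 ^ β * (a + w) * w := by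
  have hmod : (a + w) % 2 ^ floatExp β E (a + w) ≤ w := by
    have := ha.le_div_mul hβ (Nat.le_add_right a w)
    have := Nat.div_add_mod' (a + w) (2 ^ floatExp β E (a + w))
    omega
  calc 𝔼 u : Fin (2 ^ E), (floatRound β E (a + w) u : ℝ) ^ 2
      ≤ ((a + w : ℕ) : ℝ) ^ 2 + (2 ^ floatExp β E (a + w) : ℕ)
          * ((a + w) % 2 ^ floatExp β E (a + w) : ℕ) :=
        expect_roundMul_sq_le (two_pow_floatExp_dvd ..) (by positivity) _
    _ ≤ ((a + w : ℕ) : ℝ) ^ 2 + 2 / 2 ^ β * (a + w : ℕ) * w := by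
        refine add_le_add le_rfl ((two_pow_floatExp_mul_mod_le ..).trans ?_)
        gcongr
    _ = (a + w : ℝ) ^ 2 + 2 / 2 ^ β * (a + w) * w := by push_cast; rfl

end FloatingPoint

section Counter

variable {β E L : ℕ}

/-- The value of a floating-point counter that starts at `a` and receives the increments `w`, when
the roundings use the randomness `u`. -/
def counter (β E : ℕ) {L : ℕ} (w : Fin L → ℕ) (u : Fin L → Fin (2 ^ E)) (a : ℕ) : ℕ :=
  Fin.foldl L (fun a t => floatRound β E (a + w t) (u t)) a

theorem counter_cons (w : Fin (L + 1) → ℕ) (u₀ : Fin (2 ^ E)) (u : Fin L → Fin (2 ^ E)) (a : ℕ) :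
    counter β E w (Fin.cons u₀ u : Fin (L + 1) → Fin (2 ^ E)) a
      = counter β E (Fin.tail w) u (floatRound β E (a + w 0) u₀) := by
  simp only [counter, Fin.foldl_succ, Fin.cons_zero, Fin.cons_succ, Fin.tail]

theorem expect_counter (β E : ℕ) (w : Fin L → ℕ) (a : ℕ) :
    𝔼 u, (counter β E w u a : ℝ) = a + ∑ t, (w t : ℝ) := by
  induction L generalizing a with
  | zero => simp [counter]
  | succ L ih =>
    simp_rw [expect_fin_succ, counter_cons, ih, expect_add_distrib, Fintype.expect_const,
      expect_floatRound, Fin.sum_univ_succ, Fin.tail]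
    push_cast
    ring

theorem expect_counter_sq_le (hβ : 1 ≤ β) (w : Fin L → ℕ) {a : ℕ} (ha : IsFloat β E a) :
    𝔼 u, (counter β E w u a : ℝ) ^ 2
      ≤ (a + ∑ t, (w t : ℝ)) ^ 2 + 2 / 2 ^ β * (a + ∑ t, (w t : ℝ)) * ∑ t, (w t : ℝ) := by
  induction L generalizing a with
  | zero => simp [counter]
  | succ L ih =>
    set δ : ℝ := 2 / 2 ^ β
    have : 0 ≤ δ := by positivity
    set S : ℝ := ∑ t, (Fin.tail w t : ℝ)
    have : 0 ≤ S := by positivity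
    have htail : ∀ u₀ : Fin (2 ^ E),
        𝔼 u, (counter β E (Fin.tail w) u (floatRound β E (a + w 0) u₀) : ℝ) ^ 2
          ≤ (floatRound β E (a + w 0) u₀ : ℝ) ^ 2
            + (2 + δ) * S * (floatRound β E (a + w 0) u₀ : ℝ) + (1 + δ) * S ^ 2 := by
      intro u₀
      refine (ih (Fin.tail w) (isFloat_floatRound β E (a + w 0) u₀)).trans_eq ?_
      ring
    have hhead := expect_floatRound_sq_le hβ ha (w 0)
    have hcross : 0 ≤ δ * w 0 * S := by positivity
    rw [expect_fin_succ, Fin.sum_univ_succ]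
    simp_rw [counter_cons]
    refine (expect_le_expect fun u₀ _ => htail u₀).trans ?_
    rw [expect_add_distrib, expect_add_distrib, Fintype.expect_const, ← mul_expect,
      expect_floatRound]
    change _ ≤ (a + (w 0 + S)) ^ 2 + δ * (a + (w 0 + S)) * (w 0 + S)
    push_cast
    linarith

theorem uniformProb_counter_le (hβ : 1 ≤ β) (w : Fin L → ℕ) (hw : 0 < ∑ t, w t) {η : ℝ}
    (hη : 0 < η) :
    uniformProb {u : Fin L → Fin (2 ^ E) |
        η * (∑ t, w t : ℕ) < |(counter β E w u 0 : ℝ) - (∑ t, w t : ℕ)|}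
      ≤ 2 / 2 ^ β / η ^ 2 := by
  have hS : (0 : ℝ) < (∑ t, w t : ℕ) := Nat.cast_pos.2 hw
  have hmean := expect_counter β E w 0
  have hsq := expect_counter_sq_le hβ w (Or.inl zero_mem_floats : IsFloat β E 0)
  rw [← Nat.cast_sum, Nat.cast_zero, zero_add] at hmean hsq
  set S : ℝ := ((∑ t, w t : ℕ) : ℝ)
  calc uniformProb {u | η * S < |(counter β E w u 0 : ℝ) - S|}
      ≤ (𝔼 u, ((counter β E w u 0 : ℝ) - S) ^ 2) / (η * S) ^ 2 :=
        uniformProb_lt_abs_le _ (by positivity)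
    _ ≤ 2 / 2 ^ β * S ^ 2 / (η * S) ^ 2 := by
        gcongr
        rw [expect_sub_const_sq, hmean]
        linarith
    _ = 2 / 2 ^ β / η ^ 2 := by field_simp

/-- The states of a floating-point counter that saturates at `2 ^ (β + E)`. -/
abbrev CounterState (β E : ℕ) : Type := floats β E

namespace CounterState

/-- The state of a new counter. -/
def zero (β E : ℕ) : CounterState β E := ⟨0, zero_mem_floats⟩

/-- The new state after the increment `w`, when the rounding uses the randomness `u`. -/
def add (a : CounterState β E) (w : ℕ) (u : Fin (2 ^ E)) : CounterState β E :=
  ⟨min (floatRound β E (a + w) u) (2 ^ (β + E)), (isFloat_floatRound ..).min_mem_floats⟩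

theorem coe_foldl_add (w : Fin L → ℕ) (u : Fin L → Fin (2 ^ E)) :
    ((Fin.foldl L (fun a t => a.add (w t) (u t)) (zero β E) : CounterState β E) : ℕ)
      = min (counter β E w u 0) (2 ^ (β + E)) := by
  induction L with
  | zero => simp [zero, counter]
  | succ L ih =>
    have ih := ih (fun t => w t.castSucc) (fun t => u t.castSucc)
    rw [counter, Fin.foldl_succ_last, Fin.foldl_succ_last, add]
    dsimp only
    rw [ih, counter]
    set c := Fin.foldl L (fun a t => floatRound β E (a + w t.castSucc) (u t.castSucc)) 0
    rcases le_total c (2 ^ (β + E)) with h | h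
    · rw [min_eq_left h]
    · rw [min_eq_right h, floatRound_of_le (Nat.le_add_right ..),
        floatRound_of_le (h.trans (Nat.le_add_right ..)), min_eq_right (Nat.le_add_right ..),
        min_eq_right (h.trans (Nat.le_add_right ..))]

end CounterState

theorem foldl_pi {ι : Type*} {S : ι → Type*} (f : ∀ i, S i → Fin L → S i) (a : ∀ i, S i) (i : ι) :
    Fin.foldl L (fun a t i => f i (a i) t) a i = Fin.foldl L (f i) (a i) := by
  induction L with
  | zero => simp
  | succ L ih => simp [Fin.foldl_succ_last, ih fun i x t => f i x t.castSucc]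

end Counter

section Encoding

variable {n M s oL cL L : ℕ} {S O U : Type*}

/-- The streaming algorithm with the memory contents `S`, the oracles `O` and the outcomes `U` of
the coins of one update, when these are encoded by strings of bits. -/
noncomputable def Algorithm.ofEncoding (eS : S ↪ Bits s) (eO : Bits oL ≃ O) (eU : Bits cL ≃ U)
    (init : S) (upd : O → U → S → Update n M → S) (out : O → S → ℝ) : Algorithm n M s where
  oracleLen := oL
  coinLen := cL
  init := eS init
  update o u st x := eS (upd (eO o) (eU u) (Function.extend eS id (fun _ => init) st) x)
  output o st := out (eO o) (Function.extend eS id (fun _ => init) st)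

theorem Algorithm.estimate_ofEncoding (eS : S ↪ Bits s) (eO : Bits oL ≃ O) (eU : Bits cL ≃ U)
    (init : S) (upd : O → U → S → Update n M → S) (out : O → S → ℝ) (σ : Fin L → Update n M)
    (o : Bits oL) (u : Fin L → Bits cL) :
    (ofEncoding eS eO eU init upd out).estimate (o, u) σ
      = out (eO o) (Fin.foldl L (fun st t => upd (eO o) (eU (u t)) st (σ t)) init) := by
  have hstate : (ofEncoding eS eO eU init upd out).finalState (o, u) σ
      = eS (Fin.foldl L (fun st t => upd (eO o) (eU (u t)) st (σ t)) init) := by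
    simp only [finalState]
    induction L with
    | zero => simp only [Fin.foldl_zero, ofEncoding]
    | succ L ih =>
      rw [Fin.foldl_succ_last, Fin.foldl_succ_last,
        ih (fun t => σ t.castSucc) (fun t => u t.castSucc)]
      simp only [ofEncoding, eS.injective.extend_apply, id]
  rw [estimate, hstate]
  simp only [ofEncoding, eS.injective.extend_apply, id]

theorem exists_algorithm [Fintype S] [Fintype O] [Fintype U] (hS : Fintype.card S ≤ 2 ^ s)
    (hO : Fintype.card O = 2 ^ oL) (hU : Fintype.card U = 2 ^ cL)
    (init : S) (upd : O → U → S → Update n M → S) (out : O → S → ℝ) :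
    ∃ A : Algorithm n M s, ∀ (L : ℕ) (σ : Fin L → Update n M) (P : ℝ → Prop),
      A.prob {ρ : A.Randomness L | P (A.estimate ρ σ)}
        = uniformProb {p : O × (Fin L → U) |
            P (out p.1 (Fin.foldl L (fun st t => upd p.1 (p.2 t) st (σ t)) init))} := by
  obtain ⟨eS⟩ : Nonempty (S ↪ Bits s) :=
    Function.Embedding.nonempty_of_card_le (by simpa using hS)
  have eO : Bits oL ≃ O := Fintype.equivOfCardEq (by simp [hO])
  have eU : Bits cL ≃ U := Fintype.equivOfCardEq (by simp [hU])
  refine ⟨.ofEncoding eS eO eU init upd out, fun L σ P => ?_⟩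
  rw [← uniformProb_preimage_equiv (eO.prodCongr (Equiv.piCongrRight fun _ => eU))]
  exact congr_arg uniformProb (Set.ext fun ρ => iff_of_eq
    (congr_arg P (Algorithm.estimate_ofEncoding eS eO eU init upd out σ ρ.1 ρ.2)))

end Encoding

section ParetoLaplace

theorem lt_div_succ_comm (R j r : ℕ) : j < R / (r + 1) ↔ r < R / (j + 1) := by
  rw [← Nat.succ_le_iff, ← Nat.succ_le_iff, Nat.le_div_iff_mul_le r.succ_pos,
    Nat.le_div_iff_mul_le j.succ_pos, mul_comm]

-- Write each power as a geometric sum and exchange the sums: `j < R / (r + 1)` is symmetric in `j`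
-- and `r`, so `R / (j + 1)` counts the `r` with `j < R / (r + 1)`.
theorem sum_range_pow_div {A : Type*} [CommRing A] (R : ℕ) (s : A) :
    ∑ r ∈ range R, s ^ (R / (r + 1))
      = R - (1 - s) * ∑ j ∈ range R, s ^ j * (R / (j + 1) : ℕ) := by
  have hfilter : ∀ r, {j ∈ range R | j < R / (r + 1)} = range (R / (r + 1)) := by
    intro r
    ext j
    have := Nat.div_le_self R (r + 1)
    simp only [mem_filter, mem_range]
    omega
  have hgeom : ∀ r ∈ range R, s ^ (R / (r + 1))
      = 1 - (1 - s) * ∑ j ∈ range R, if j < R / (r + 1) then s ^ j else 0 := by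
    intro r _
    rw [← sum_filter, hfilter, mul_neg_geom_sum, sub_sub_cancel]
  rw [sum_congr rfl hgeom, sum_sub_distrib, ← mul_sum, sum_comm, sum_const, card_range, nsmul_one]
  congr 2
  refine sum_congr rfl fun j _ => ?_
  simp_rw [lt_div_succ_comm R j]
  rw [← sum_filter, hfilter, sum_const, card_range, nsmul_eq_mul, mul_comm]

theorem natCast_div_succ_div_mem_Icc {R : ℕ} (hR : 0 < R) (j : ℕ) :
    ((R / (j + 1) : ℕ) / R : ℝ) ∈ Set.Icc (1 / (j + 1 : ℝ) - 1 / R) (1 / (j + 1)) := by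
  have hR' : (0 : ℝ) < R := Nat.cast_pos.2 hR
  have hlow : ((R / (j + 1) : ℕ) * (j + 1) : ℝ) ≤ R := mod_cast Nat.div_mul_le_self R (j + 1)
  have hhigh : (R : ℝ) ≤ (j + 1) * ((R / (j + 1) : ℕ) + 1) :=
    mod_cast (Nat.lt_mul_div_succ R j.succ_pos).le
  constructor
  · rw [sub_le_iff_le_add, ← add_div, div_le_div_iff₀ (by positivity) hR']
    linarith
  · rw [div_le_div_iff₀ hR' (by positivity)]
    linarith

theorem abs_sum_pow_mul_div_add_log_le {R : ℕ} (hR : 0 < R) {s : ℝ} (hs0 : 0 < s) (hs1 : s < 1) :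
    |∑ j ∈ range R, s ^ j * ((R / (j + 1) : ℕ) / R : ℝ) + Real.log (1 - s) / s|
      ≤ (1 - s)⁻¹ * (1 / R) := by
  have hlog : HasSum (fun j : ℕ => s ^ j * (1 / (j + 1 : ℝ))) (-Real.log (1 - s) / s) := by
    refine ((Real.hasSum_pow_div_log_of_abs_lt_one
      (by rwa [abs_of_pos hs0])).div_const s).congr_fun fun j => ?_
    rw [pow_succ]
    field_simp
  have hfloor : HasSum (fun j : ℕ => s ^ j * ((R / (j + 1) : ℕ) / R : ℝ))
      (∑ j ∈ range R, s ^ j * ((R / (j + 1) : ℕ) / R : ℝ)) := by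
    refine hasSum_sum_of_ne_finset_zero fun j hj => ?_
    rw [Nat.div_eq_of_lt (by rw [mem_range] at hj; omega), Nat.cast_zero, zero_div, mul_zero]
  have hgeom : HasSum (fun j : ℕ => s ^ j * (1 / (R : ℝ))) ((1 - s)⁻¹ * (1 / R)) :=
    (hasSum_geometric_of_lt_one hs0.le hs1).mul_right _
  have hdiff := hlog.sub hfloor
  have hbounds := natCast_div_succ_div_mem_Icc hR
  have hdiff_nonneg := hdiff.nonneg fun j =>
    sub_nonneg.2 (mul_le_mul_of_nonneg_left (hbounds j).2 (pow_nonneg hs0.le j))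
  have hdiff_le := hasSum_le (fun j => by
    have := mul_le_mul_of_nonneg_left (hbounds j).1 (pow_nonneg hs0.le j)
    linarith) hdiff hgeom
  rw [abs_of_nonpos (by linarith [neg_div s (Real.log (1 - s))])]
  linarith [neg_div s (Real.log (1 - s))]

/-- The Laplace transform at `z` of `⌊R / r⌋` for `r` uniform in `{1, …, R}`, a discrete Pareto
distribution with tail exponent `1`. -/
noncomputable def paretoLaplace (R : ℕ) (z : ℝ) : ℝ :=
  𝔼 r : Fin R, Real.exp (-(z * (R / ((r : ℕ) + 1) : ℕ)))

theorem paretoLaplace_eq {R : ℕ} (hR : 0 < R) (z : ℝ) :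
    paretoLaplace R z = 1 - (1 - Real.exp (-z))
      * ∑ j ∈ range R, Real.exp (-z) ^ j * ((R / (j + 1) : ℕ) / R : ℝ) := by
  have hR' : (R : ℝ) ≠ 0 := by positivity
  have hpow : ∀ m : ℕ, Real.exp (-(z * m)) = Real.exp (-z) ^ m := fun m => by
    rw [← Real.exp_nat_mul, mul_neg, mul_comm]
  simp_rw [paretoLaplace, Fintype.expect_eq_sum_div_card, Fintype.card_fin, hpow]
  rw [Fin.sum_univ_eq_sum_range fun r => Real.exp (-z) ^ (R / (r + 1)), sum_range_pow_div, sub_div,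
    div_self hR', mul_div_assoc, sum_div]
  simp_rw [mul_div_assoc]

theorem abs_paretoLaplace_sub_le {R : ℕ} (hR : 0 < R) {z : ℝ} (hz : 0 < z) :
    |paretoLaplace R z - (1 + (Real.exp z - 1) * Real.log (1 - Real.exp (-z)))| ≤ 1 / R := by
  have hs1 : Real.exp (-z) < 1 := Real.exp_lt_one_iff.2 (neg_lt_zero.2 hz)
  have hsum := abs_sum_pow_mul_div_add_log_le hR (Real.exp_pos (-z)) hs1
  rw [paretoLaplace_eq hR, show Real.exp z = (Real.exp (-z))⁻¹ by rw [Real.exp_neg, inv_inv]]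
  have hs0 : 0 < Real.exp (-z) := Real.exp_pos (-z)
  set s := Real.exp (-z)
  set F := ∑ j ∈ range R, s ^ j * ((R / (j + 1) : ℕ) / R : ℝ)
  have heq : 1 - (1 - s) * F - (1 + (s⁻¹ - 1) * Real.log (1 - s))
      = -((1 - s) * (F + Real.log (1 - s) / s)) := by
    field_simp
    ring
  rw [heq, abs_neg, abs_mul, abs_of_pos (sub_pos.2 hs1)]
  calc (1 - s) * |F + Real.log (1 - s) / s| ≤ (1 - s) * ((1 - s)⁻¹ * (1 / R)) := by gcongr
    _ = 1 / R := mul_inv_cancel_left₀ (sub_pos.2 hs1).ne' _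

theorem abs_log_one_add_sub_le {x : ℝ} (hx : |x| ≤ 1 / 2) : |Real.log (1 + x) - x| ≤ 2 * x ^ 2 := by
  have h := Real.abs_log_sub_add_sum_range_le (x := -x) (by rw [abs_neg]; linarith) 1
  simp only [sum_range_one, zero_add, pow_one, Nat.cast_zero, div_one, sub_neg_eq_add, abs_neg,
    one_add_one_eq_two, sq_abs] at h
  calc |Real.log (1 + x) - x| = |-x + Real.log (1 + x)| := by rw [neg_add_eq_sub]
    _ ≤ x ^ 2 / (1 - |x|) := h
    _ ≤ 2 * x ^ 2 := by
        rw [div_le_iff₀ (by linarith)]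
        nlinarith [sq_nonneg x]

theorem abs_log_one_sub_exp_neg_sub_log_le {z : ℝ} (hz : 0 < z) (hz1 : z ≤ 1 / 2) :
    |Real.log (1 - Real.exp (-z)) - Real.log z| ≤ 2 * z := by
  have hexp := abs_le.1 <| Real.abs_exp_sub_one_sub_id_le (x := -z)
    (by rw [abs_neg, abs_of_pos hz]; linarith)
  have hpos : 0 < z * (1 - z) := mul_pos hz (by linarith)
  have hlow : z * (1 - z) ≤ 1 - Real.exp (-z) := by nlinarith
  have hhigh : 1 - Real.exp (-z) ≤ z := by linarith [Real.add_one_le_exp (-z)]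
  have hloglow := Real.log_le_log hpos hlow
  have hloghigh := Real.log_le_log (hpos.trans_le hlow) hhigh
  rw [Real.log_mul hz.ne' (by linarith)] at hloglow
  have hlog : -(2 * z) ≤ Real.log (1 - z) := by
    refine le_trans ?_ (Real.one_sub_inv_le_log_of_pos (by linarith : 0 < 1 - z))
    have : (1 - z)⁻¹ ≤ 1 + 2 * z := by
      rw [inv_le_iff_one_le_mul₀ (by linarith)]
      nlinarith
    linarith
  rw [abs_le]
  constructor <;> linarith

theorem abs_exp_sub_one_mul_log_sub_le {z : ℝ} (hz : 0 < z) (hz1 : z ≤ 1 / 2) :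
    |(Real.exp z - 1) * Real.log (1 - Real.exp (-z)) - z * Real.log z|
      ≤ z ^ 2 * (|Real.log z| + 3) := by
  have hexp : |Real.exp z - 1 - z| ≤ z ^ 2 :=
    Real.abs_exp_sub_one_sub_id_le (by rw [abs_of_pos hz]; linarith)
  have hexp' : |Real.exp z - 1| ≤ 3 / 2 * z := by
    rw [abs_of_nonneg (by linarith [Real.add_one_le_exp z])]
    nlinarith [(abs_le.1 hexp).2]
  calc |(Real.exp z - 1) * Real.log (1 - Real.exp (-z)) - z * Real.log z|
      = |(Real.exp z - 1 - z) * Real.log z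
          + (Real.exp z - 1) * (Real.log (1 - Real.exp (-z)) - Real.log z)| := by ring_nf
    _ ≤ |Real.exp z - 1 - z| * |Real.log z|
          + |Real.exp z - 1| * |Real.log (1 - Real.exp (-z)) - Real.log z| := by
        rw [← abs_mul, ← abs_mul]
        exact abs_add_le _ _
    _ ≤ z ^ 2 * |Real.log z| + 3 / 2 * z * (2 * z) := by
        gcongr
        exact abs_log_one_sub_exp_neg_sub_log_le hz hz1
    _ = z ^ 2 * (|Real.log z| + 3) := by ring

section Asymptotics

variable {R : ℕ} {z Λ τ : ℝ}

theorem abs_paretoLaplace_sub_one_sub_le (hR : 0 < R) (hz : 0 < z) (hΛ : |Real.log z| ≤ Λ)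
    (hΛ3 : 3 ≤ Λ) (hτ : τ ≤ 1 / 8) (hzΛ : z * Λ ^ 2 ≤ τ) (hRτ : 1 / R ≤ τ * z) :
    |paretoLaplace R z - 1 - z * Real.log z| ≤ 2 * τ * z := by
  have hzτ : z * 9 ≤ τ := le_trans (by gcongr; nlinarith) hzΛ
  have herror : z ^ 2 * (|Real.log z| + 3) ≤ τ * z :=
    calc z ^ 2 * (|Real.log z| + 3) ≤ z ^ 2 * Λ ^ 2 := by gcongr; nlinarith
      _ = z * Λ ^ 2 * z := by ring
      _ ≤ τ * z := by gcongr
  set G := (Real.exp z - 1) * Real.log (1 - Real.exp (-z))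
  calc |paretoLaplace R z - 1 - z * Real.log z|
      = |(paretoLaplace R z - (1 + G)) + (G - z * Real.log z)| := by ring_nf
    _ ≤ |paretoLaplace R z - (1 + G)| + |G - z * Real.log z| := abs_add_le _ _
    _ ≤ 1 / R + z ^ 2 * (|Real.log z| + 3) :=
        add_le_add (abs_paretoLaplace_sub_le hR hz)
          (abs_exp_sub_one_mul_log_sub_le hz (by linarith))
    _ ≤ 2 * τ * z := by linarith

theorem paretoLaplace_pos (hR : 0 < R) (z : ℝ) : 0 < paretoLaplace R z :=
  have : Nonempty (Fin R) := ⟨⟨0, hR⟩⟩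
  expect_exp_pos _

theorem abs_log_paretoLaplace_sub_le (hR : 0 < R) (hz : 0 < z) (hΛ : |Real.log z| ≤ Λ)
    (hΛ3 : 3 ≤ Λ) (hτ : τ ≤ 1 / 8) (hzΛ : z * Λ ^ 2 ≤ τ) (hRτ : 1 / R ≤ τ * z) :
    |Real.log (paretoLaplace R z) - z * Real.log z| ≤ 10 * τ * z := by
  have hdev := abs_paretoLaplace_sub_one_sub_le hR hz hΛ hΛ3 hτ hzΛ hRτ
  obtain ⟨x, hx⟩ : ∃ x, paretoLaplace R z = 1 + x := ⟨_, (add_sub_cancel _ _).symm⟩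
  rw [hx, add_sub_cancel_left] at hdev
  have hxΛ : |x| ≤ 2 * (z * Λ) :=
    calc |x| = |(x - z * Real.log z) + z * Real.log z| := by rw [sub_add_cancel]
      _ ≤ |x - z * Real.log z| + |z * Real.log z| := abs_add_le _ _
      _ ≤ 2 * τ * z + z * Λ := by rw [abs_mul, abs_of_pos hz]; gcongr
      _ ≤ 2 * (z * Λ) := by nlinarith
  have hxsq : x ^ 2 ≤ 4 * τ * z :=
    calc x ^ 2 = |x| ^ 2 := (sq_abs x).symm
      _ ≤ (2 * (z * Λ)) ^ 2 := by gcongr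
      _ = 4 * z * (z * Λ ^ 2) := by ring
      _ ≤ 4 * z * τ := by gcongr
      _ = 4 * τ * z := by ring
  have hzτ : z * 9 ≤ τ := le_trans (by gcongr; nlinarith) hzΛ
  have hxhalf : |x| ≤ 1 / 2 := abs_le_of_sq_le_sq (by nlinarith) (by norm_num)
  calc |Real.log (paretoLaplace R z) - z * Real.log z|
      = |(Real.log (1 + x) - x) + (x - z * Real.log z)| := by rw [hx, sub_add_sub_cancel]
    _ ≤ |Real.log (1 + x) - x| + |x - z * Real.log z| := abs_add_le _ _
    _ ≤ 2 * (4 * τ * z) + 2 * τ * z := by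
        gcongr
        exact (abs_log_one_add_sub_le hxhalf).trans (by gcongr)
    _ = 10 * τ * z := by ring

end Asymptotics

end ParetoLaplace

section Entropy

variable {n : ℕ} {x : Fin n → ℕ}

theorem le_l1 (x : Fin n → ℕ) (i : Fin n) : x i ≤ l1 x :=
  single_le_sum (fun _ _ => Nat.zero_le _) (mem_univ i)

theorem l1_pos (hx : x ≠ 0) : 0 < l1 x := by
  obtain ⟨i, hi⟩ := Function.ne_iff.1 hx
  exact (Nat.pos_of_ne_zero hi).trans_le (le_l1 x i)

theorem l1_mul_entropy (hx : x ≠ 0) :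
    l1 x * entropy x = ∑ i, (x i : ℝ) * Real.log (l1 x / x i) := by
  have hF : (l1 x : ℝ) ≠ 0 := Nat.cast_ne_zero.2 (l1_pos hx).ne'
  rw [entropy, mul_sum]
  refine sum_congr rfl fun i _ => ?_
  field_simp

theorem entropy_le_log (hx : x ≠ 0) : entropy x ≤ Real.log (l1 x) := by
  have hF : (0 : ℝ) < l1 x := Nat.cast_pos.2 (l1_pos hx)
  refine le_of_mul_le_mul_left ?_ hF
  rw [l1_mul_entropy hx]
  calc ∑ i, (x i : ℝ) * Real.log (l1 x / x i) ≤ ∑ i, (x i : ℝ) * Real.log (l1 x) := by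
        refine sum_le_sum fun i _ => ?_
        rcases (x i).eq_zero_or_pos with hi | hi
        · simp [hi]
        · have hi' : (1 : ℝ) ≤ x i := Nat.one_le_cast.2 hi
          gcongr
          exact div_le_self hF.le hi'
    _ = l1 x * Real.log (l1 x) := by rw [← sum_mul, l1, Nat.cast_sum]

theorem sum_mul_log_eq (hx : x ≠ 0) {b : ℝ} (hb : 0 < b) :
    ∑ i, b * x i * Real.log (b * x i) = b * l1 x * (Real.log (b * l1 x) - entropy x) := by
  have hF : (0 : ℝ) < l1 x := Nat.cast_pos.2 (l1_pos hx)
  have hterm : ∀ i, b * x i * Real.log (b * x i)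
      = b * (x i * Real.log (b * l1 x)) - b * (x i * Real.log (l1 x / x i)) := by
    intro i
    rcases (x i).eq_zero_or_pos with hi | hi
    · simp [hi]
    · have hi' : (0 : ℝ) < x i := Nat.cast_pos.2 hi
      rw [Real.log_mul hb.ne' hi'.ne', Real.log_mul hb.ne' hF.ne', Real.log_div hF.ne' hi'.ne']
      ring
  rw [sum_congr rfl fun i _ => hterm i, sum_sub_distrib, ← mul_sum, ← mul_sum, ← sum_mul,
    ← l1_mul_entropy hx, ← Nat.cast_sum]
  change b * (l1 x * _) - _ = _
  ring

end Entropy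

section Sketch

variable {n N R : ℕ}

/-- The randomness of one linear sketch: `N` independent numbers of `{1, …, R}` for each coordinate.
The number `r` is encoded by `r - 1`. -/
abbrev Seed (n N R : ℕ) : Type := Fin n → Fin N → Fin R

/-- The weight of coordinate `i` in the linear sketch with randomness `ω`: a sum of `N` independent
discrete Pareto variables `⌊R / r⌋`. -/
def sketchWeight (ω : Seed n N R) (i : Fin n) : ℕ := ∑ l, R / ((ω i l : ℕ) + 1)

/-- The linear sketch of the vector `x` with randomness `ω`. -/
def sketch (x : Fin n → ℕ) (ω : Seed n N R) : ℕ := ∑ i, x i * sketchWeight ω i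

theorem sketch_le (x : Fin n → ℕ) (ω : Seed n N R) : sketch x ω ≤ l1 x * (N * R) := by
  rw [sketch, l1, sum_mul]
  refine sum_le_sum fun i _ => Nat.mul_le_mul_left _ ?_
  calc sketchWeight ω i ≤ ∑ _l : Fin N, R := sum_le_sum fun l _ => Nat.div_le_self _ _
    _ = N * R := by rw [sum_const, card_univ, Fintype.card_fin, smul_eq_mul]

theorem sketch_pos {x : Fin n → ℕ} (hx : x ≠ 0) (hN : 0 < N) (ω : Seed n N R) :
    0 < sketch x ω := by
  refine (l1_pos hx).trans_le (sum_le_sum fun i _ => Nat.le_mul_of_pos_right _ ?_)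
  exact sum_pos (fun l _ => Nat.div_pos (ω i l).isLt (Nat.succ_pos _)) ⟨⟨0, hN⟩, mem_univ _⟩

theorem expect_exp_neg_sketch (x : Fin n → ℕ) (b : ℝ) :
    𝔼 ω : Seed n N R, Real.exp (-(b * sketch x ω)) = ∏ i, paretoLaplace R (b * x i) ^ N := by
  have hcoord : ∀ i, paretoLaplace R (b * x i) ^ N
      = 𝔼 ω : Fin N → Fin R, Real.exp (-(b * x i * ∑ l, ((R / ((ω l : ℕ) + 1) : ℕ) : ℝ))) := by
    intro i
    simp_rw [mul_sum, ← sum_neg_distrib, Real.exp_sum]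
    rw [expect_prod_apply fun (_ : Fin N) (r : Fin R) =>
      Real.exp (-(b * x i * (R / ((r : ℕ) + 1) : ℕ))), prod_const, card_univ, Fintype.card_fin]
    rfl
  simp_rw [hcoord]
  rw [← expect_prod_apply fun i (ω : Fin N → Fin R) =>
    Real.exp (-(b * x i * ∑ l, ((R / ((ω l : ℕ) + 1) : ℕ) : ℝ)))]
  refine expect_congr rfl fun ω _ => ?_
  rw [← Real.exp_sum, sum_neg_distrib, sketch, Nat.cast_sum, mul_sum]
  simp only [sketchWeight, Nat.cast_mul, Nat.cast_sum, mul_assoc]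

theorem paretoLaplace_zero (hR : 0 < R) : paretoLaplace R 0 = 1 := by
  have : Nonempty (Fin R) := ⟨⟨0, hR⟩⟩
  simp [paretoLaplace]

theorem abs_log_expect_exp_neg_sketch_sub_le (hR : 0 < R) {x : Fin n → ℕ} (hx : x ≠ 0) {b τ : ℝ}
    (hb : 0 < b) (hτ : ∀ i, x i ≠ 0 →
      |Real.log (paretoLaplace R (b * x i)) - b * x i * Real.log (b * x i)| ≤ τ * (b * x i)) :
    |Real.log (𝔼 ω : Seed n N R, Real.exp (-(b * sketch x ω)))
        - N * (b * l1 x * (Real.log (b * l1 x) - entropy x))| ≤ N * (τ * (b * l1 x)) := by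
  have hcoord : ∀ i,
      |Real.log (paretoLaplace R (b * x i)) - b * x i * Real.log (b * x i)| ≤ τ * (b * x i) := by
    intro i
    rcases eq_or_ne (x i) 0 with hi | hi
    · simp [hi, paretoLaplace_zero hR]
    · exact hτ i hi
  rw [expect_exp_neg_sketch, Real.log_prod fun i _ => (pow_pos (paretoLaplace_pos hR _) N).ne',
    ← sum_mul_log_eq hx hb]
  simp_rw [Real.log_pow]
  rw [← mul_sum, ← mul_sub, ← sum_sub_distrib, abs_mul, Nat.abs_cast]
  gcongr
  calc |∑ i, (Real.log (paretoLaplace R (b * x i)) - b * x i * Real.log (b * x i))|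
      ≤ ∑ i, τ * (b * x i) := (abs_sum_le_sum_abs _ _).trans (sum_le_sum fun i _ => hcoord i)
    _ = τ * (b * l1 x) := by rw [← mul_sum, ← mul_sum, ← Nat.cast_sum]; rfl

end Sketch

section SketchParameters

variable {n X k : ℕ} {x : Fin n → ℕ} {e : ℝ}

-- With `N = X ^ 4` Pareto variables per coordinate, the arguments `z = a * x i / (N * ‖x‖₁)` of the
-- Laplace transform lie in `[X⁻⁵, 2 * X⁻⁴]`, so that the cutoff `R = X ^ 7` costs `1 / R ≪ z`.
theorem abs_log_paretoLaplace_pow_seven_sub_le (he1 : e ≤ 1) (heX : 512 ≤ e * X) {z : ℝ}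
    (hz : 1 / (X : ℝ) ^ 5 ≤ z) (hz' : z ≤ 2 / (X : ℝ) ^ 4) :
    |Real.log (paretoLaplace (X ^ 7) z) - z * Real.log z| ≤ e * z := by
  have hX : (512 : ℝ) ≤ X := heX.trans (mul_le_of_le_one_left X.cast_nonneg he1)
  have hX0 : (0 : ℝ) < X := by linarith
  have he : 0 < e := pos_of_mul_pos_left (by linarith) hX0.le
  have hz0 : 0 < z := lt_of_lt_of_le (by positivity) hz
  have hz1 : z ≤ 1 := hz'.trans <| by
    rw [div_le_one (by positivity)]
    linarith [le_self_pow₀ (by linarith : (1 : ℝ) ≤ X) (by norm_num : 4 ≠ 0)]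
  have hlog : |Real.log z| ≤ 5 * X := by
    rw [abs_of_nonpos (Real.log_nonpos hz0.le hz1)]
    have := Real.log_le_log (by positivity) hz
    rw [one_div, Real.log_inv, Real.log_pow] at this
    push_cast at this
    linarith [Real.log_le_self hX0.le]
  have hsq : z * (5 * X) ^ 2 ≤ e / 16 :=
    calc z * (5 * X) ^ 2 ≤ 2 / (X : ℝ) ^ 4 * (5 * X) ^ 2 := by gcongr
      _ = 50 / (X : ℝ) ^ 2 := by field_simp; ring
      _ ≤ e / 16 := by rw [div_le_iff₀ (by positivity)]; nlinarith
  have hX2 : 1 / (X : ℝ) ^ 2 ≤ e / 16 := by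
    rw [div_le_iff₀ (by positivity)]
    nlinarith
  have htail : 1 / ((X ^ 7 : ℕ) : ℝ) ≤ e / 16 * z :=
    calc 1 / ((X ^ 7 : ℕ) : ℝ) = 1 / (X : ℝ) ^ 2 * (1 / (X : ℝ) ^ 5) := by
          push_cast
          field_simp
      _ ≤ e / 16 * z := mul_le_mul hX2 hz (by positivity) (by positivity)
  refine (abs_log_paretoLaplace_sub_le (pow_pos (Nat.cast_pos.1 hX0) 7) hz0 hlog (by linarith)
    (by linarith) hsq htail).trans ?_
  gcongr
  linarith

theorem abs_log_expect_exp_neg_div_sub_le (hx : x ≠ 0) (hX : l1 x ≤ X) (he1 : e ≤ 1)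
    (heX : 512 ≤ e * X) {a : ℝ} (ha1 : 1 ≤ a) (ha2 : a ≤ 2) :
    |Real.log (𝔼 ω : Seed n (X ^ 4) (X ^ 7),
          Real.exp (-(a * (sketch x ω / ((X ^ 4 : ℕ) * l1 x)))))
        - a * (Real.log (a / (X ^ 4 : ℕ)) - entropy x)| ≤ e * a := by
  have hF : (0 : ℝ) < l1 x := Nat.cast_pos.2 (l1_pos hx)
  have hFX : (l1 x : ℝ) ≤ X := Nat.cast_le.2 hX
  have hX0 : (0 : ℝ) < X := hF.trans_le hFX
  have hXpos : 0 < X := Nat.cast_pos.1 hX0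
  set b : ℝ := a / ((X ^ 4 : ℕ) * l1 x) with hb
  have hN : ((X ^ 4 : ℕ) : ℝ) = (X : ℝ) ^ 4 := Nat.cast_pow X 4
  have hcoord : ∀ i, x i ≠ 0 →
      |Real.log (paretoLaplace (X ^ 7) (b * x i)) - b * x i * Real.log (b * x i)|
        ≤ e * (b * x i) := by
    intro i hi
    have hi1 : (1 : ℝ) ≤ x i := Nat.one_le_cast.2 (Nat.pos_of_ne_zero hi)
    have hiF : (x i : ℝ) ≤ l1 x := Nat.cast_le.2 (le_l1 x i)
    apply abs_log_paretoLaplace_pow_seven_sub_le he1 heX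
    · rw [hb, hN, div_mul_eq_mul_div, div_le_div_iff₀ (by positivity) (by positivity)]
      calc 1 * ((X : ℝ) ^ 4 * l1 x) ≤ 1 * 1 * ((X : ℝ) ^ 4 * X) := by rw [one_mul (1 : ℝ)]; gcongr
        _ ≤ a * x i * (X : ℝ) ^ 5 := by rw [← pow_succ]; gcongr
    · rw [hb, hN, div_mul_eq_mul_div, div_le_div_iff₀ (by positivity) (by positivity)]
      calc a * x i * (X : ℝ) ^ 4 ≤ 2 * l1 x * (X : ℝ) ^ 4 := by gcongr
        _ = 2 * ((X : ℝ) ^ 4 * l1 x) := by ring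
  have hbF : b * l1 x = a / (X ^ 4 : ℕ) := by rw [hb]; field_simp
  have hNb : ((X ^ 4 : ℕ) : ℝ) * (b * l1 x) = a := by rw [hbF]; field_simp
  have hexp : ∀ ω : Seed n (X ^ 4) (X ^ 7),
      a * (sketch x ω / ((X ^ 4 : ℕ) * l1 x)) = b * sketch x ω := fun ω => by rw [hb]; ring
  have hlog := abs_log_expect_exp_neg_sketch_sub_le (N := X ^ 4) (pow_pos hXpos 7) hx
    (by positivity) hcoord
  rw [mul_left_comm _ e, ← mul_assoc _ (b * _), hNb, hbF] at hlog
  simpa only [hexp] using hlog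

end SketchParameters

section Concentration

variable {n X k : ℕ} {x : Fin n → ℕ} {e : ℝ}

theorem abs_sub_le_of_abs_log_sub_log_le {p q : ℝ} (hp : 0 < p) (hq : 0 < q) (he : e ≤ 1)
    (h : |Real.log p - Real.log q| ≤ e) : |p - q| ≤ 2 * e * q := by
  have hpq : p - q = q * (Real.exp (Real.log p - Real.log q) - 1) := by
    rw [Real.exp_sub, Real.exp_log hp, Real.exp_log hq]
    field_simp
  rw [hpq, abs_mul, abs_of_pos hq, mul_comm]
  gcongr
  linarith [Real.abs_exp_sub_one_le (h.trans he)]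

theorem uniformProb_lt_abs_sampleMean_sub_le_of_abs_expect_sub_le {Ω : Type*} [Fintype Ω]
    [Nonempty Ω] {f : Ω → ℝ} (hk : 0 < k) {t δ μ : ℝ} (ht : 0 < t) (hμ : |𝔼 ω, f ω - μ| ≤ δ) :
    uniformProb {o : Fin k → Ω | t + δ < |(∑ j, f (o j)) / k - μ|}
      ≤ (𝔼 ω, f ω ^ 2) / (k * t ^ 2) := by
  refine le_trans (uniformProb_mono ?_) (uniformProb_lt_abs_sampleMean_sub_le f hk ht)
  simp only [Set.ofPred_subset_ofPred]
  intro o ho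
  linarith [abs_sub_le ((∑ j, f (o j)) / k) (𝔼 ω, f ω) μ]

/-- The empirical Laplace transform of the sample `Y`, at the point `1`. -/
noncomputable def sampleLaplace (Y : Fin k → ℝ) : ℝ := (∑ j, Real.exp (-(Y j))) / k

theorem abs_expect_exp_neg_sketch_sub_le (hx : x ≠ 0) (hX : l1 x ≤ X) (he1 : e ≤ 1)
    (heX : 512 ≤ e * X) :
    |𝔼 ω : Seed n (X ^ 4) (X ^ 7), Real.exp (-(sketch x ω / ((X ^ 4 : ℕ) * l1 x)))
        - Real.exp (-entropy x) / (X ^ 4 : ℕ)| ≤ 2 * e * (Real.exp (-entropy x) / (X ^ 4 : ℕ)) := by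
  have hX0 : 0 < X := (l1_pos hx).trans_le hX
  have : Nonempty (Fin (X ^ 7)) := ⟨⟨0, pow_pos hX0 7⟩⟩
  have hlog := abs_log_expect_exp_neg_div_sub_le hx hX he1 heX le_rfl one_le_two
  simp only [one_mul, mul_one] at hlog
  refine abs_sub_le_of_abs_log_sub_log_le (expect_exp_pos _) (by positivity) he1 ?_
  rwa [Real.log_div (Real.exp_ne_zero _) (by positivity), Real.log_exp, ← neg_add', add_comm,
    neg_add', ← Real.log_inv, ← one_div]

theorem expect_exp_neg_sketch_sq_le (hx : x ≠ 0) (hX : l1 x ≤ X) (he1 : e ≤ 1 / 4)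
    (heX : 512 ≤ e * X) :
    𝔼 ω : Seed n (X ^ 4) (X ^ 7), Real.exp (-(sketch x ω / ((X ^ 4 : ℕ) * l1 x))) ^ 2
      ≤ 8 * (Real.exp (-entropy x) / (X ^ 4 : ℕ)) ^ 2 := by
  have hX0 : 0 < X := (l1_pos hx).trans_le hX
  have : Nonempty (Fin (X ^ 7)) := ⟨⟨0, pow_pos hX0 7⟩⟩
  set μ : ℝ := Real.exp (-entropy x) / (X ^ 4 : ℕ) with hμ
  have hsq : ∀ ω : Seed n (X ^ 4) (X ^ 7),
      Real.exp (-(sketch x ω / ((X ^ 4 : ℕ) * l1 x))) ^ 2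
        = Real.exp (-(2 * (sketch x ω / ((X ^ 4 : ℕ) * l1 x)))) := by
    intro ω
    rw [← Real.exp_nat_mul]
    push_cast
    ring_nf
  have hlogμ : Real.log (4 * μ ^ 2) = 2 * (Real.log (2 / (X ^ 4 : ℕ)) - entropy x) := by
    rw [show 4 * μ ^ 2 = (2 * μ) ^ 2 by ring, hμ, mul_div_left_comm, Real.log_pow,
      Real.log_mul (Real.exp_ne_zero _) (by positivity), Real.log_exp]
    push_cast
    ring
  have hlog := abs_log_expect_exp_neg_div_sub_le hx hX (by linarith) heX one_le_two le_rfl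
  rw [← hlogμ] at hlog
  have habs := abs_sub_le_of_abs_log_sub_log_le (expect_exp_pos _) (by positivity)
    (by linarith) hlog
  simp only [hsq]
  nlinarith [(abs_le.1 habs).2]

theorem uniformProb_lt_abs_sampleLaplace_sketch_sub_le (hx : x ≠ 0) (hX : l1 x ≤ X)
    (he1 : e ≤ 1 / 4) (heX : 512 ≤ e * X) (hk : 64 ≤ k * e ^ 2) :
    uniformProb {o : Fin k → Seed n (X ^ 4) (X ^ 7) |
      3 * e * (Real.exp (-entropy x) / (X ^ 4 : ℕ))
        < |sampleLaplace (fun j => sketch x (o j) / ((X ^ 4 : ℕ) * l1 x))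
          - Real.exp (-entropy x) / (X ^ 4 : ℕ)|} ≤ 1 / 8 := by
  have hX0 : 0 < X := (l1_pos hx).trans_le hX
  have he0 : 0 < e := pos_of_mul_pos_left (by linarith) X.cast_nonneg
  have hk0 : 0 < k := Nat.pos_of_ne_zero fun h => by norm_num [h] at hk
  have hμ0 : 0 < Real.exp (-entropy x) / (X ^ 4 : ℕ) := by positivity
  have hmean := abs_expect_exp_neg_sketch_sub_le hx hX (by linarith) heX
  have hsq := expect_exp_neg_sketch_sq_le hx hX he1 heX
  have : Nonempty (Fin (X ^ 7)) := ⟨⟨0, pow_pos hX0 7⟩⟩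
  generalize Real.exp (-entropy x) / ((X ^ 4 : ℕ) : ℝ) = μ at hμ0 hmean hsq ⊢
  have hdev := uniformProb_lt_abs_sampleMean_sub_le_of_abs_expect_sub_le hk0
    (mul_pos he0 hμ0) hmean
  rw [← add_mul, show e + 2 * e = 3 * e by ring] at hdev
  refine hdev.trans ?_
  rw [div_le_iff₀ (by positivity)]
  calc _ ≤ 8 * μ ^ 2 := hsq
    _ = 1 / 8 * (64 * μ ^ 2) := by ring
    _ ≤ 1 / 8 * (k * e ^ 2 * μ ^ 2) := by gcongr
    _ = 1 / 8 * (k * (e * μ) ^ 2) := by ring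

end Concentration

section Perturbation

variable {n X k : ℕ} {x : Fin n → ℕ} {e η : ℝ}

theorem abs_div_sub_div_le {S S' F F' : ℝ} (hS : 0 ≤ S) (hF : 0 < F) (hη : η ≤ 1 / 2)
    (hSS' : |S' - S| ≤ η * S) (hFF' : |F' - F| ≤ η * F) :
    |S' / F' - S / F| ≤ 4 * η * (S / F) := by
  have hF' : F / 2 ≤ F' := by nlinarith [(abs_le.1 hFF').1]
  have hF'0 : 0 < F' := by linarith
  have hη0 : 0 ≤ η := nonneg_of_mul_nonneg_left ((abs_nonneg _).trans hFF') hF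
  have hdiff : S' / F' - S / F = ((S' - S) - S / F * (F' - F)) / F' := by
    field_simp
    ring
  have hnum : |(S' - S) - S / F * (F' - F)| ≤ 2 * η * S :=
    calc _ ≤ |S' - S| + |S / F * (F' - F)| := abs_sub _ _
      _ ≤ η * S + S / F * (η * F) := by
          rw [abs_mul, abs_of_nonneg (div_nonneg hS hF.le)]
          gcongr
      _ = 2 * η * S := by field_simp; ring
  rw [hdiff, abs_div, abs_of_pos hF'0]
  calc _ ≤ 2 * η * S / (F / 2) := by gcongr
    _ = 4 * η * (S / F) := by field_simp; ring

-- For `Y ≤ T` the relative error `κ` of `Y` is an absolute error of at most `κ * T`; for `Y ≥ T`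
-- both exponentials are negligible.
theorem abs_exp_neg_sub_exp_neg_le {Y Y' κ T ν : ℝ} (hY : 0 ≤ Y) (hκ : κ ≤ 1 / 2)
    (h : |Y' - Y| ≤ κ * Y) (hκ0 : 0 ≤ κ) (hT : κ * T ≤ e) (he : 0 ≤ e) (he1 : e ≤ 1)
    (hν : Real.exp (-(T / 2)) ≤ ν) :
    |Real.exp (-Y') - Real.exp (-Y)| ≤ 2 * e * Real.exp (-Y) + ν := by
  rcases le_total Y T with hYT | hYT
  · have hlog : |Real.log (Real.exp (-Y')) - Real.log (Real.exp (-Y))| ≤ e := by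
      rw [Real.log_exp, Real.log_exp, neg_sub_neg, abs_sub_comm]
      exact h.trans ((by gcongr : κ * Y ≤ κ * T).trans hT)
    have := abs_sub_le_of_abs_log_sub_log_le (Real.exp_pos _) (Real.exp_pos _) he1 hlog
    linarith [Real.exp_pos (-(T / 2))]
  · have hY' : Y / 2 ≤ Y' := by nlinarith [(abs_le.1 h).1]
    calc |Real.exp (-Y') - Real.exp (-Y)| ≤ max (Real.exp (-Y')) (Real.exp (-Y)) :=
          abs_sub_le_iff.2 ⟨(sub_le_self _ (Real.exp_nonneg _)).trans (le_max_left _ _),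
            (sub_le_self _ (Real.exp_nonneg _)).trans (le_max_right _ _)⟩
      _ ≤ Real.exp (-(T / 2)) := max_le (by gcongr; linarith) (by gcongr; linarith)
      _ ≤ 2 * e * Real.exp (-Y) + ν := by linarith [mul_nonneg he (Real.exp_nonneg (-Y))]

theorem abs_sampleLaplace_sub_le (hk : 0 < k) {Y Y' : Fin k → ℝ} {κ T ν : ℝ} (hY : ∀ j, 0 ≤ Y j)
    (hκ : κ ≤ 1 / 2) (h : ∀ j, |Y' j - Y j| ≤ κ * Y j) (hκ0 : 0 ≤ κ) (hT : κ * T ≤ e)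
    (he : 0 ≤ e) (he1 : e ≤ 1) (hν : Real.exp (-(T / 2)) ≤ ν) :
    |sampleLaplace Y' - sampleLaplace Y| ≤ 2 * e * sampleLaplace Y + ν := by
  have hk' : (0 : ℝ) < k := Nat.cast_pos.2 hk
  rw [sampleLaplace, sampleLaplace, ← sub_div, abs_div, Nat.abs_cast, div_le_iff₀ hk',
    ← sum_sub_distrib]
  calc _ ≤ ∑ j, |Real.exp (-(Y' j)) - Real.exp (-(Y j))| := abs_sum_le_sum_abs _ _
    _ ≤ ∑ j, (2 * e * Real.exp (-(Y j)) + ν) := sum_le_sum fun j _ =>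
        abs_exp_neg_sub_exp_neg_le (hY j) hκ (h j) hκ0 hT he he1 hν
    _ = (2 * e * ((∑ j, Real.exp (-(Y j))) / k) + ν) * k := by
        rw [sum_add_distrib, ← mul_sum, sum_const, card_univ, Fintype.card_fin, nsmul_eq_mul]
        field_simp

theorem abs_log_sub_log_le {p q δ : ℝ} (hq : 0 < q) (hδ : δ ≤ 1 / 2) (h : |p - q| ≤ δ * q) :
    |Real.log p - Real.log q| ≤ 2 * δ := by
  have hr : |p / q - 1| ≤ δ := by
    rwa [div_sub_one hq.ne', abs_div, abs_of_pos hq, div_le_iff₀ hq]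
  have hlog := abs_log_one_add_sub_le (hr.trans hδ)
  have hp : 0 < p := by nlinarith [(abs_le.1 h).1]
  rw [add_sub_cancel, Real.log_div hp.ne' hq.ne'] at hlog
  have hsq : 2 * (p / q - 1) ^ 2 ≤ |p / q - 1| := by
    rw [← sq_abs]
    nlinarith [abs_nonneg (p / q - 1)]
  linarith [abs_sub_abs_le_abs_sub (Real.log p - Real.log q) (p / q - 1)]

/-- The entropy estimate computed from an approximation `a none` of the `ℓ₁` norm and the
approximations `a (some j)` of `k` linear sketches with `N` Pareto variables per coordinate. -/
noncomputable def entropyEstimate (N : ℕ) (a : Option (Fin k) → ℝ) : ℝ :=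
  -Real.log (sampleLaplace fun j => a (some j) / (N * a none)) - Real.log N

theorem exp_neg_six_mul_log_le (hx : x ≠ 0) (hX : l1 x ≤ X) (heX : 1 ≤ e * X) :
    Real.exp (-(12 * Real.log X / 2)) ≤ e * (Real.exp (-entropy x) / (X ^ 4 : ℕ)) := by
  have hX0 : (0 : ℝ) < X := Nat.cast_pos.2 ((l1_pos hx).trans_le hX)
  have hH : entropy x ≤ Real.log X := (entropy_le_log hx).trans
    (Real.log_le_log (Nat.cast_pos.2 (l1_pos hx)) (Nat.cast_le.2 hX))
  have he : 1 / (X : ℝ) ≤ e := by rwa [div_le_iff₀ hX0]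
  calc Real.exp (-(12 * Real.log X / 2)) = 1 / X * (Real.exp (-Real.log X) / (X ^ 4 : ℕ)) := by
        rw [show -(12 * Real.log X / 2) = (6 : ℕ) * -Real.log X by push_cast; ring,
          Real.exp_nat_mul, Real.exp_neg, Real.exp_log hX0]
        push_cast
        field_simp
    _ ≤ e * (Real.exp (-entropy x) / (X ^ 4 : ℕ)) := by
        have : 0 ≤ e := le_trans (by positivity) he
        gcongr

theorem abs_entropyEstimate_sub_le (hk : 0 < k) (hx : x ≠ 0) (hX : l1 x ≤ X) (he1 : e ≤ 1 / 32)
    (heX : 512 ≤ e * X) (hη : 48 * η * Real.log X ≤ e) {S : Fin k → ℕ} {a : Option (Fin k) → ℝ}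
    (hnone : |a none - l1 x| ≤ η * l1 x) (hsome : ∀ j, |a (some j) - S j| ≤ η * S j)
    (hlaplace : |sampleLaplace (fun j => S j / ((X ^ 4 : ℕ) * l1 x))
        - Real.exp (-entropy x) / (X ^ 4 : ℕ)| ≤ 3 * e * (Real.exp (-entropy x) / (X ^ 4 : ℕ))) :
    |entropyEstimate (X ^ 4) a - entropy x| ≤ 14 * e := by
  have hF0 : (0 : ℝ) < l1 x := Nat.cast_pos.2 (l1_pos hx)
  have hX0 : (0 : ℝ) < X := hF0.trans_le (Nat.cast_le.2 hX)
  have he0 : 0 < e := pos_of_mul_pos_left (by linarith) hX0.le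
  have hη0 : 0 ≤ η := nonneg_of_mul_nonneg_left ((abs_nonneg _).trans hnone) hF0
  have hlogX : 1 ≤ Real.log X := by
    rw [Real.le_log_iff_exp_le hX0]
    nlinarith [Real.exp_one_lt_d9]
  have hη1 : η ≤ 1 / 8 := by nlinarith
  have hN0 : (0 : ℝ) < (X ^ 4 : ℕ) := Nat.cast_pos.2 (pow_pos (Nat.cast_pos.1 hX0) 4)
  have hY : ∀ j, |a (some j) / ((X ^ 4 : ℕ) * a none) - S j / ((X ^ 4 : ℕ) * l1 x)|
      ≤ 4 * η * (S j / ((X ^ 4 : ℕ) * l1 x)) := by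
    intro j
    simp_rw [mul_comm ((X ^ 4 : ℕ) : ℝ), ← div_div]
    rw [← sub_div, abs_div, abs_of_pos hN0, ← mul_div_assoc]
    gcongr
    exact abs_div_sub_div_le (Nat.cast_nonneg _) hF0 (by linarith) (hsome j) hnone
  have hpert := abs_sampleLaplace_sub_le hk (fun j => by positivity) (by linarith) hY
    (by positivity) (by linarith) he0.le (by linarith)
    (exp_neg_six_mul_log_le (e := e) hx hX (by linarith))
  have hlogμ : Real.log (Real.exp (-entropy x) / (X ^ 4 : ℕ))
      = -entropy x - Real.log (X ^ 4 : ℕ) := by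
    rw [Real.log_div (Real.exp_ne_zero _) hN0.ne', Real.log_exp]
  set μ : ℝ := Real.exp (-entropy x) / (X ^ 4 : ℕ)
  set Z := sampleLaplace fun j => (S j : ℝ) / ((X ^ 4 : ℕ) * l1 x)
  have hμ0 : 0 < μ := by positivity
  have hclose : |sampleLaplace (fun j => a (some j) / ((X ^ 4 : ℕ) * a none)) - μ|
      ≤ 7 * e * μ := by
    have hZ : e * Z ≤ e * ((1 + 3 * e) * μ) := by gcongr; linarith [(abs_le.1 hlaplace).2]
    have hee : e * e * μ ≤ e * (1 / 32) * μ := by gcongr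
    exact (abs_sub_le _ Z μ).trans (by linarith [mul_pos he0 hμ0])
  have hlog := abs_log_sub_log_le hμ0 (by linarith) hclose
  rw [hlogμ] at hlog
  rw [entropyEstimate, abs_sub_comm]
  exact (congr_arg abs (by ring)).trans_le (hlog.trans_eq (by ring))

end Perturbation

section Algorithm

variable {n M k N R L : ℕ}

theorem sum_mul_freq (σ : Fin L → Update n M) (f : Fin n → ℕ) :
    ∑ i, freq σ i * f i = ∑ t, ((σ t).2 : ℕ) * f (σ t).1 := by
  simp_rw [freq, sum_mul]
  rw [sum_comm]
  simp only [ite_mul, zero_mul, sum_ite_eq, mem_univ, if_true]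

theorem l1_freq (σ : Fin L → Update n M) : l1 (freq σ) = ∑ t, ((σ t).2 : ℕ) := by
  simpa only [mul_one, l1] using sum_mul_freq σ fun _ => 1

theorem l1_freq_le (σ : Fin L → Update n M) : l1 (freq σ) ≤ L * M := by
  rw [l1_freq]
  calc _ ≤ ∑ _t : Fin L, M := sum_le_sum fun t _ => Nat.lt_succ_iff.1 (σ t).2.isLt
    _ = L * M := by rw [sum_const, card_univ, Fintype.card_fin, smul_eq_mul]

/-- The increments of the counters at an update: the counter `none` holds the `ℓ₁` norm of the
frequency vector, and the counter `some j` holds its linear sketch with randomness `o j`. -/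
def counterWeight (o : Fin k → Seed n N R) : Option (Fin k) → Update n M → ℕ
  | none, x => x.2
  | some j, x => x.2 * sketchWeight (o j) x.1

theorem sum_counterWeight_none (o : Fin k → Seed n N R) (σ : Fin L → Update n M) :
    ∑ t, counterWeight o none (σ t) = l1 (freq σ) :=
  (l1_freq σ).symm

theorem sum_counterWeight_some (o : Fin k → Seed n N R) (σ : Fin L → Update n M) (j : Fin k) :
    ∑ t, counterWeight o (some j) (σ t) = sketch (freq σ) (o j) :=
  (sum_mul_freq σ (sketchWeight (o j))).symm

theorem sum_counterWeight_pos (o : Fin k → Seed n N R) {σ : Fin L → Update n M} (hσ : freq σ ≠ 0)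
    (hN : 0 < N) (j : Option (Fin k)) : 0 < ∑ t, counterWeight o j (σ t) := by
  cases j with
  | none => exact sum_counterWeight_none o σ ▸ l1_pos hσ
  | some j => exact sum_counterWeight_some o σ j ▸ sketch_pos hσ hN _

theorem sum_counterWeight_le (o : Fin k → Seed n N R) (σ : Fin L → Update n M) (hN : 0 < N)
    (hR : 0 < R) (j : Option (Fin k)) :
    ∑ t, counterWeight o j (σ t) ≤ l1 (freq σ) * (N * R) := by
  cases j with
  | none =>
    rw [sum_counterWeight_none]
    exact Nat.le_mul_of_pos_right _ (Nat.mul_pos hN hR)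
  | some j => exact sum_counterWeight_some o σ j ▸ sketch_le _ _

/-- The contents of the counters `i ∈ ι` after the increments `W i 0, …, W i (L - 1)`. All counters
use the same coins, which the union bound over their failures permits. -/
def counterStates {ι : Type*} (β E : ℕ) (W : ι → Fin L → ℕ) (u : Fin L → Fin (2 ^ E)) :
    ι → CounterState β E :=
  Fin.foldl L (fun st t i => (st i).add (W i t) (u t)) fun _ => .zero β E

theorem uniformProb_exists_lt_abs_counterStates_sub_le {ι : Type*} [Fintype ι] {β E : ℕ}
    (hβ : 1 ≤ β) {W : ι → Fin L → ℕ} (hpos : ∀ i, 0 < ∑ t, W i t) (hle : ∀ i, ∑ t, W i t ≤ 2 ^ E)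
    {η : ℝ} (hη : 0 < η) :
    uniformProb {u : Fin L → Fin (2 ^ E) | ∃ i, η * (∑ t, W i t : ℕ)
        < |((counterStates β E W u i : ℕ) : ℝ) - (∑ t, W i t : ℕ)|}
      ≤ Fintype.card ι * (2 / 2 ^ β / η ^ 2) := by
  have hmin : ∀ u i, |((counterStates β E W u i : ℕ) : ℝ) - (∑ t, W i t : ℕ)|
      ≤ |(counter β E (W i) u 0 : ℝ) - (∑ t, W i t : ℕ)| := by
    intro u i
    have hcap : ∑ t, W i t ≤ 2 ^ (β + E) :=
      (hle i).trans (Nat.pow_le_pow_right two_pos (Nat.le_add_left E β))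
    rw [counterStates, foldl_pi fun i (a : CounterState β E) t => a.add (W i t) (u t),
      CounterState.coe_foldl_add]
    conv_lhs => rw [← min_eq_left hcap, Nat.cast_min, Nat.cast_min]
    exact abs_inf_sub_inf_le_abs (counter β E (W i) u 0 : ℝ) (∑ t, W i t : ℕ) (2 ^ (β + E) : ℕ)
  calc _ ≤ uniformProb (⋃ i, {u : Fin L → Fin (2 ^ E) | η * (∑ t, W i t : ℕ)
        < |(counter β E (W i) u 0 : ℝ) - (∑ t, W i t : ℕ)|}) := by
        refine uniformProb_mono ?_
        rintro u ⟨i, hi⟩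
        exact Set.mem_iUnion.2 ⟨i, hi.trans_le (hmin u i)⟩
    _ ≤ ∑ i, uniformProb {u : Fin L → Fin (2 ^ E) | η * (∑ t, W i t : ℕ)
        < |(counter β E (W i) u 0 : ℝ) - (∑ t, W i t : ℕ)|} := uniformProb_iUnion_le _
    _ ≤ ∑ _i : ι, 2 / 2 ^ β / η ^ 2 :=
        sum_le_sum fun i _ => uniformProb_counter_le hβ (W i) (hpos i) hη
    _ = Fintype.card ι * (2 / 2 ^ β / η ^ 2) := by rw [sum_const, card_univ, nsmul_eq_mul]

theorem card_counterStates_le {β E t : ℕ} (ht : (2 ^ β + 1) * (E + 1) ≤ 2 ^ t) :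
    Fintype.card (Option (Fin k) → CounterState β E) ≤ 2 ^ (t * (k + 1)) := by
  rw [Fintype.card_fun, Fintype.card_option, Fintype.card_fin, Fintype.card_coe, pow_mul]
  exact Nat.pow_le_pow_left ((card_floats_le β E).trans ht) _

end Algorithm

section Algorithm

variable {n M k w β t L : ℕ} {e η : ℝ}

theorem uniformProb_exists_lt_abs_counterStates_counterWeight_sub_le (hβ : 1 ≤ β) (hη : 0 < η)
    (hβη : (k + 1) * (2 / 2 ^ β / η ^ 2) ≤ 1 / 8)
    (o : Fin k → Seed n ((2 ^ w) ^ 4) ((2 ^ w) ^ 7)) {σ : Fin L → Update n M} (hσ : freq σ ≠ 0)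
    (hw : l1 (freq σ) ≤ 2 ^ w) :
    uniformProb {u : Fin L → Fin (2 ^ (12 * w)) | ∃ j,
      η * (∑ t, counterWeight o j (σ t) : ℕ)
        < |((counterStates β (12 * w) (fun j t => counterWeight o j (σ t)) u j : ℕ) : ℝ)
          - (∑ t, counterWeight o j (σ t) : ℕ)|} ≤ 1 / 8 := by
  refine (uniformProb_exists_lt_abs_counterStates_sub_le hβ
    (sum_counterWeight_pos o hσ (by positivity)) (fun j => ?_) hη).trans ?_
  · calc ∑ t, counterWeight o j (σ t) ≤ l1 (freq σ) * ((2 ^ w) ^ 4 * (2 ^ w) ^ 7) :=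
          sum_counterWeight_le o σ (by positivity) (by positivity) j
      _ ≤ 2 ^ w * ((2 ^ w) ^ 4 * (2 ^ w) ^ 7) := Nat.mul_le_mul_right _ hw
      _ = 2 ^ (12 * w) := by ring
  · simpa only [Fintype.card_option, Fintype.card_fin, Nat.cast_add, Nat.cast_one] using hβη

theorem exists_entropy_algorithm (n M : ℕ) (he1 : e ≤ 1 / 32) (heX : 512 ≤ e * (2 ^ w : ℕ))
    (hk : 64 ≤ k * e ^ 2) (hη : 0 < η) (hηw : 48 * η * Real.log (2 ^ w : ℕ) ≤ e) (hβ : 1 ≤ β)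
    (hβη : (k + 1) * (2 / 2 ^ β / η ^ 2) ≤ 1 / 8) (ht : (2 ^ β + 1) * (12 * w + 1) ≤ 2 ^ t) :
    ∃ A : Algorithm n M (t * (k + 1)), ∀ (L : ℕ) (σ : Fin L → Update n M), freq σ ≠ 0 →
      l1 (freq σ) ≤ 2 ^ w →
        3 / 4 ≤ A.prob {ρ : A.Randomness L | |A.estimate ρ σ - entropy (freq σ)| ≤ 14 * e} := by
  have hk0 : 0 < k := Nat.pos_of_ne_zero fun h => by norm_num [h] at hk
  have hO : Fintype.card (Fin k → Seed n ((2 ^ w) ^ 4) ((2 ^ w) ^ 7))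
      = 2 ^ (w * 7 * (2 ^ w) ^ 4 * n * k) := by
    simp only [Fintype.card_fun, Fintype.card_fin, ← pow_mul]
  obtain ⟨A, hA⟩ := exists_algorithm (n := n) (M := M) (card_counterStates_le (k := k) ht) hO
    (Fintype.card_fin (2 ^ (12 * w))) (fun _ => .zero β (12 * w))
    (fun o u st x j => (st j).add (counterWeight o j x) u)
    (fun _ st => entropyEstimate ((2 ^ w) ^ 4) fun j => ((st j : ℕ) : ℝ))
  refine ⟨A, fun L σ hσ hw => ?_⟩
  rw [hA L σ fun y => |y - entropy (freq σ)| ≤ 14 * e]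
  have : Nonempty (Fin ((2 ^ w) ^ 7)) := ⟨⟨0, by positivity⟩⟩
  refine le_trans (by norm_num) (one_sub_sub_le_uniformProb
    (uniformProb_lt_abs_sampleLaplace_sketch_sub_le hσ hw (by linarith) heX hk)
    (fun o => uniformProb_exists_lt_abs_counterStates_counterWeight_sub_le hβ hη hβη o hσ hw)
    fun o u ho hu => ?_)
  have hcounter := fun j => not_lt.1 fun h => hu ⟨j, h⟩
  have hnone := hcounter none
  have hsome := fun j => hcounter (some j)
  simp only [sum_counterWeight_none, sum_counterWeight_some] at hnone hsome
  exact abs_entropyEstimate_sub_le hk0 hσ hw he1 heX hηw hnone hsome (not_lt.1 ho)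

end Algorithm

section Parameters

theorem one_lt_log_three : 1 < Real.log 3 := by
  rw [Real.lt_log_iff_exp_lt (by norm_num)]
  linarith [Real.exp_one_lt_d9]

theorem exists_two_pow_between {x : ℝ} (hx : 1 ≤ x) :
    ∃ a : ℕ, x < 2 ^ a ∧ (2 : ℝ) ^ a ≤ 2 * x := by
  obtain ⟨a, ha, ha'⟩ := exists_nat_pow_near hx one_lt_two
  exact ⟨a + 1, ha', by rw [pow_succ]; linarith⟩

theorem natCast_le_add_log_of_two_pow_le {t a b : ℕ} {q : ℝ} (hq : 1 ≤ q)
    (h : (2 : ℝ) ^ t ≤ 2 ^ a * q ^ b) : (t : ℝ) ≤ a + 2 * b * Real.log q := by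
  have hlog2 : 1 / 2 ≤ Real.log 2 := by linarith [Real.log_two_gt_d9]
  have hlog := Real.log_le_log (by positivity) h
  rw [Real.log_mul (by positivity) (by positivity), Real.log_pow, Real.log_pow, Real.log_pow]
    at hlog
  have hb : 0 ≤ b * Real.log q := mul_nonneg b.cast_nonneg (Real.log_nonneg hq)
  refine le_of_mul_le_mul_right ?_ (by linarith : 0 < Real.log 2)
  nlinarith

theorem exists_counter_parameters (k : ℕ) {w : ℕ} (hw : 1 ≤ w) {e : ℝ} (he : 0 < e)
    (he1 : e ≤ 1) :
    ∃ (η : ℝ) (β t : ℕ), 0 < η ∧ 48 * η * Real.log (2 ^ w : ℕ) ≤ e ∧ 1 ≤ β ∧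
      (k + 1) * (2 / 2 ^ β / η ^ 2) ≤ 1 / 8 ∧ (2 ^ β + 1) * (12 * w + 1) ≤ 2 ^ t ∧
      (2 : ℝ) ^ t ≤ 2 ^ 22 * (k + 1) * w ^ 3 / e ^ 2 := by
  have hw' : (1 : ℝ) ≤ w := Nat.one_le_cast.2 hw
  set η : ℝ := e / (48 * w) with hη_def
  have hη : 0 < η := by positivity
  have hη1 : η ^ 2 ≤ 1 := pow_le_one₀ hη.le (by rw [hη_def, div_le_one (by positivity)]; linarith)
  have hx : 16 ≤ 16 * (k + 1) / η ^ 2 := by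
    rw [le_div_iff₀ (by positivity)]
    nlinarith [(k.cast_nonneg : (0 : ℝ) ≤ k)]
  obtain ⟨β, hβ, hβ'⟩ := exists_two_pow_between (le_trans (by norm_num) hx)
  obtain ⟨t, ht, ht'⟩ := exists_two_pow_between (x := (2 ^ β + 1) * (12 * w + 1))
    (one_le_mul_of_one_le_of_one_le (by linarith) (by linarith))
  refine ⟨η, β, t, hη, ?_, ?_, ?_, by exact_mod_cast ht.le, ?_⟩
  · have hlog2 : Real.log 2 ≤ 1 := by linarith [Real.log_two_lt_d9]
    calc 48 * η * Real.log (2 ^ w : ℕ) = e * Real.log 2 := by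
          rw [Nat.cast_pow, Real.log_pow, hη_def]
          field_simp
          norm_num
      _ ≤ e := mul_le_of_le_one_right he.le hlog2
  · by_contra! h
    rw [Nat.lt_one_iff.1 h] at hβ
    linarith
  · rw [div_lt_iff₀ (by positivity)] at hβ
    rw [div_div, mul_div_assoc', div_le_iff₀ (by positivity)]
    linarith
  · calc (2 : ℝ) ^ t ≤ 2 * ((2 ^ β + 2 ^ β) * (12 * w + w)) := ht'.trans (by gcongr; linarith)
      _ = 52 * w * 2 ^ β := by ring
      _ ≤ 52 * w * (2 * (16 * (k + 1) / η ^ 2)) := by gcongr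
      _ = 3833856 * (k + 1) * w ^ 3 / e ^ 2 := by rw [hη_def]; field_simp; norm_num
      _ ≤ 2 ^ 22 * (k + 1) * w ^ 3 / e ^ 2 := by gcongr; norm_num

theorem exists_sketch_parameters {B : ℕ} (hB : 3 ≤ B) {ε : ℝ} (hε : 0 < ε) (hε1 : ε < 1) :
    ∃ k w : ℕ, 64 ≤ k * (ε / 32) ^ 2 ∧ (k + 1 : ℝ) ≤ 2 ^ 17 / ε ^ 2 ∧ B ≤ 2 ^ w ∧
      512 ≤ ε / 32 * (2 ^ w : ℕ) ∧ 1 ≤ w ∧ (w : ℝ) ≤ 2 ^ 5 * (Real.log B / ε) := by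
  have hB' : (3 : ℝ) ≤ B := by exact_mod_cast hB
  have hlogB : 1 ≤ Real.log B :=
    one_lt_log_three.le.trans (Real.log_le_log (by norm_num) hB')
  have hε2 : 1 ≤ 1 / ε ^ 2 := one_le_one_div (by positivity) (pow_le_one₀ hε.le hε1.le)
  have hBε : B ≤ B / ε := le_div_self (by positivity) hε hε1.le
  obtain ⟨w, hw, hw'⟩ := exists_two_pow_between (x := 2 ^ 14 * (B / ε)) (by linarith)
  refine ⟨⌈64 / (ε / 32) ^ 2⌉₊, w, ?_, ?_, ?_, ?_, ?_, ?_⟩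
  · exact (div_le_iff₀ (by positivity)).1 (Nat.le_ceil _)
  · have hceil := (Nat.ceil_lt_add_one (by positivity : 0 ≤ 64 / (ε / 32) ^ 2)).le
    have heq : 64 / (ε / 32) ^ 2 = 65536 * (1 / ε ^ 2) := by field_simp; norm_num
    rw [div_eq_mul_one_div (2 ^ 17)]
    linarith
  · exact_mod_cast (by linarith : (B : ℝ) ≤ 2 ^ w)
  · have hmul : 2 ^ 14 * (B / ε) * ε ≤ 2 ^ w * ε := by gcongr
    rw [mul_assoc, div_mul_cancel₀ _ hε.ne'] at hmul
    push_cast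
    linarith
  · by_contra! h
    rw [Nat.lt_one_iff.1 h] at hw
    linarith
  · have hlog := natCast_le_add_log_of_two_pow_le (t := w) (a := 15) (b := 1) (q := B / ε)
      (by linarith) (by linarith)
    rw [div_eq_mul_one_div, Real.log_mul (by positivity) (by positivity)] at hlog
    have hlogε : Real.log (1 / ε) ≤ 1 / ε := Real.log_le_self (by positivity)
    have hq : Real.log B ≤ Real.log B / ε := le_div_self (by positivity) hε hε1.le
    have hq' : 1 / ε ≤ Real.log B / ε := by gcongr
    push_cast at hlog
    linarith

theorem log_log_three_pos : 0 < Real.log (Real.log 3) := Real.log_pos one_lt_log_three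

theorem log_log_three_le {B : ℕ} (hB : 3 ≤ B) :
    Real.log (Real.log 3) ≤ Real.log (Real.log B) := by
  have hlog : Real.log 3 ≤ Real.log B := Real.log_le_log (by norm_num) (by exact_mod_cast hB)
  exact Real.log_le_log (by linarith [one_lt_log_three]) hlog

theorem exists_parameters {B : ℕ} (hB : 3 ≤ B) {ε : ℝ} (hε : 0 < ε) (hε1 : ε < 1) :
    ∃ (k w β t : ℕ) (η : ℝ), 512 ≤ ε / 32 * (2 ^ w : ℕ) ∧ 64 ≤ k * (ε / 32) ^ 2 ∧ 0 < η ∧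
      48 * η * Real.log (2 ^ w : ℕ) ≤ ε / 32 ∧ 1 ≤ β ∧ (k + 1) * (2 / 2 ^ β / η ^ 2) ≤ 1 / 8 ∧
      (2 ^ β + 1) * (12 * w + 1) ≤ 2 ^ t ∧ B ≤ 2 ^ w ∧
      ((t * (k + 1) : ℕ) : ℝ) ≤ 2 ^ 17 * (64 / Real.log (Real.log 3) + 14)
        * (1 / ε ^ 2 * (Real.log (Real.log B) + Real.log (1 / ε))) := by
  obtain ⟨k, w, hk, hk', hBw, hεw, hw, hw'⟩ := exists_sketch_parameters hB hε hε1
  obtain ⟨η, β, t, hη, hηw, hβ, hβη, ht, ht'⟩ :=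
    exists_counter_parameters k hw (by positivity : 0 < ε / 32) (by linarith)
  refine ⟨k, w, β, t, η, hεw, hk, hη, hηw, hβ, hβη, ht, hBw, ?_⟩
  have hc₀ := log_log_three_pos
  have hcB := log_log_three_le hB
  have hlogB : 1 ≤ Real.log B :=
    one_lt_log_three.le.trans (Real.log_le_log (by norm_num) (by exact_mod_cast hB))
  have hlogε : 0 ≤ Real.log (1 / ε) := Real.log_nonneg (one_le_one_div hε hε1.le)
  set q : ℝ := Real.log B / ε with hq
  have hεq : 1 / ε ≤ q := by rw [hq]; gcongr
  have hq1 : 1 ≤ q := (one_le_one_div hε hε1.le).trans hεq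
  have htq : (2 : ℝ) ^ t ≤ 2 ^ 64 * q ^ 7 :=
    calc (2 : ℝ) ^ t ≤ 2 ^ 22 * (2 ^ 17 / ε ^ 2) * (2 ^ 5 * q) ^ 3 / (ε / 32) ^ 2 :=
          ht'.trans (by gcongr)
      _ = 2 ^ 64 * (1 / ε) ^ 4 * q ^ 3 := by field_simp; norm_num
      _ ≤ 2 ^ 64 * q ^ 4 * q ^ 3 := by gcongr
      _ = 2 ^ 64 * q ^ 7 := by ring
  have hlogq : Real.log q = Real.log (Real.log B) + Real.log (1 / ε) := by
    rw [hq, div_eq_mul_one_div, Real.log_mul (by positivity) (by positivity)]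
  set ℓ := Real.log (Real.log B) + Real.log (1 / ε)
  have htℓ : (t : ℝ) ≤ (64 / Real.log (Real.log 3) + 14) * ℓ := by
    have hlog := natCast_le_add_log_of_two_pow_le hq1 htq
    have h64 : 64 ≤ 64 / Real.log (Real.log 3) * ℓ := by
      rw [div_mul_eq_mul_div, le_div_iff₀ hc₀]
      linarith
    rw [hlogq] at hlog
    push_cast at hlog
    linarith
  push_cast
  calc (t : ℝ) * (k + 1) ≤ (64 / Real.log (Real.log 3) + 14) * ℓ * (2 ^ 17 / ε ^ 2) :=
        mul_le_mul htℓ hk' (by positivity) (t.cast_nonneg.trans htℓ)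
    _ = 2 ^ 17 * (64 / Real.log (Real.log 3) + 14) * (1 / ε ^ 2 * ℓ) := by ring

theorem log_log_pow_add_le {n a : ℕ} (hn : 3 ≤ n) (ha : 1 ≤ a) {ℓ : ℝ} (hℓ : 0 ≤ ℓ) :
    Real.log (Real.log (n ^ a : ℕ)) + ℓ
      ≤ (1 + Real.log a / Real.log (Real.log 3)) * (Real.log (Real.log n) + ℓ) := by
  have hc₀ := log_log_three_pos
  have hcn := log_log_three_le hn
  have ha' : (1 : ℝ) ≤ a := Nat.one_le_cast.2 ha
  have hlogn : 0 < Real.log n := Real.log_pos (by exact_mod_cast (by lia : 1 < n))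
  have hloga : Real.log a
      ≤ Real.log a / Real.log (Real.log 3) * (Real.log (Real.log n) + ℓ) := by
    rw [div_mul_eq_mul_div, le_div_iff₀ hc₀]
    exact mul_le_mul_of_nonneg_left (by linarith) (Real.log_nonneg ha')
  rw [Nat.cast_pow, Real.log_pow, Real.log_mul (by positivity) hlogn.ne']
  linarith

end Parameters

end EntropyStream

theorem theorem5p4_general :
    ∃ C : ℝ, 0 < C ∧ ∀ (n M B : ℕ) (ε : ℝ), 3 ≤ B → 0 < ε → ε < 1 →
      ∃ (s : ℕ) (A : EntropyStream.Algorithm n M s),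
        (s : ℝ) ≤ C * (1 / ε ^ 2 * (Real.log (Real.log B) + Real.log (1 / ε))) ∧
        ∀ (L : ℕ) (σ : Fin L → EntropyStream.Update n M), EntropyStream.freq σ ≠ 0 →
          EntropyStream.l1 (EntropyStream.freq σ) ≤ B →
            3 / 4 ≤ A.prob {ρ : A.Randomness L |
              |A.estimate ρ σ - EntropyStream.entropy (EntropyStream.freq σ)| ≤ ε} := by
  have hc₀ := EntropyStream.log_log_three_pos
  refine ⟨2 ^ 17 * (64 / Real.log (Real.log 3) + 14), by positivity,
    fun n M B ε hB hε hε1 => ?_⟩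
  obtain ⟨k, w, β, t, η, hεw, hk, hη, hηw, hβ, hβη, ht, hBw, hspace⟩ :=
    EntropyStream.exists_parameters hB hε hε1
  obtain ⟨A, hA⟩ := EntropyStream.exists_entropy_algorithm n M (by linarith) hεw hk hη hηw hβ
    hβη ht
  refine ⟨t * (k + 1), A, hspace, fun L σ hσ hl1 => (hA L σ hσ (hl1.trans hBw)).trans ?_⟩
  exact EntropyStream.uniformProb_mono
    (Set.ofPred_subset_ofPred.2 fun ρ hρ => hρ.trans (by linarith))

theorem theorem5p4 (c : ℕ) :
    ∃ C : ℝ, 0 < C ∧ ∀ (n m M : ℕ) (ε : ℝ), 3 ≤ n → m ≤ n ^ c → M ≤ n ^ c → 0 < ε → ε < 1 →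
      ∃ (s : ℕ) (A : EntropyStream.Algorithm n M s),
        (s : ℝ) ≤ C * (1 / ε ^ 2 * (Real.log (Real.log n) + Real.log (1 / ε))) ∧
        ∀ (L : ℕ), L ≤ m → ∀ σ : Fin L → EntropyStream.Update n M,
          EntropyStream.freq σ ≠ 0 →
            3 / 4 ≤ A.prob {ρ : A.Randomness L |
              |A.estimate ρ σ - EntropyStream.entropy (EntropyStream.freq σ)| ≤ ε} := by
  obtain ⟨C, hC, h⟩ := theorem5p4_general
  have hc₀ := EntropyStream.log_log_three_pos
  refine ⟨C * (1 + Real.log (2 * c + 1 : ℕ) / Real.log (Real.log 3)), by positivity,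
    fun n m M ε hn hm hM hε hε1 => ?_⟩
  have hB : 3 ≤ n ^ (2 * c + 1) := hn.trans (Nat.le_self_pow (Nat.succ_ne_zero _) n)
  have hlog := EntropyStream.log_log_pow_add_le hn (Nat.succ_pos (2 * c))
    (Real.log_nonneg (one_le_one_div hε hε1.le))
  obtain ⟨s, A, hs, hA⟩ := h n M (n ^ (2 * c + 1)) ε hB hε hε1
  refine ⟨s, A, hs.trans ?_, fun L hL σ hσ => hA L σ hσ ?_⟩
  · rw [mul_assoc C, mul_left_comm (1 + _)]
    exact mul_le_mul_of_nonneg_left (mul_le_mul_of_nonneg_left hlog (by positivity)) hC.le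
  · calc _ ≤ L * M := EntropyStream.l1_freq_le σ
      _ ≤ n ^ c * n ^ c := Nat.mul_le_mul (hL.trans hm) hM
      _ = n ^ (2 * c) := by ring
      _ ≤ n ^ (2 * c + 1) := Nat.pow_le_pow_right (by lia) (by lia)
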